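/- Let $n\ge 1$ and let $C=\{y^2=x^{2n}\}\subset(\mathbb{C}^2,0)$ be the plane curve singularity of type $A_{2n-1}$, with two branches $C_1,C_2$ and uniformisations $\gamma_i:(\mathbb{C},0)\to(C_i,0)$. For $f\in\mathcal{O}=\mathcal{O}_{\mathbb{C}^2,0}$ let $v_i(f)=\mathrm{Ord}_0 f(\gamma_i(t))$. A subset of $\mathbb{P}\mathcal{O}$ is cylindric if for some $m$ it is the preimage of a constructible set $Y$ in the projectivised space $\mathbb{P}j_m(\mathcal{O})$ of $m$-jets; its motivic measure is $\mu=[Y]\cdot\mathbb{L}^{-\dim \mathbb{P}j_m(\mathcal{O})}\in K_0(\mathrm{Var}_{\mathbb{C}})[\mathbb{L}^{-1}]$, where $\mathbb{L}$ is the class of the affine line and $\dim\mathbb{P}j_m(\mathcal{O})=\frac{(m+1)(m+2)}{2}-1$. Put $q=\mathbb{L}^{-1}$. Then all the sets $\{v_1=a,\ v_2=b\}\subset\mathbb{P}\mathcal{O}$ with $a,b\in\mathbb{Z}_{\ge0}$ are cylindric, and the reduced motivic Poincaré series $$\overline{P}_g(t_1,t_2)=(1-qt_1)(1-qt_2)\int_{\mathbb{P}\mathcal{O}}t_1^{v_1}t_2^{v_2}\,d\mu=(1-qt_1)(1-qt_2)\sum_{a,b\ge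 0}\mu(\{v_1=a,\ v_2=b\})\,t_1^at_2^b$$ equals $$\Bigl[1+\sum_{k=1}^{n-1}(q^k+q^{k+1})(t_1t_2)^k+q^n(t_1t_2)^n\Bigr]-(t_1+t_2)\sum_{k=0}^{n-1}q^{k+1}(t_1t_2)^k .$$ The same formula holds in $\mathbb{Z}[q][[t_1,t_2]]$, with $q$ a formal variable, for $(1-qt_1)(1-qt_2)P$, where $P$ is the series defined by the filtration $J_{\underline v}=\{f\in\mathcal{O}: v_i(f)\ge v_i,\ i=1,2\}$, $\underline{v}\in\mathbb{Z}^2$, with codimensions $h(\underline v)=\dim_{\mathbb{C}}\mathcal{O}/J_{\underline v}$: $$P(t_1,t_2;q)=\frac{(t_1-1)(t_2-1)}{t_1t_2-1}\sum_{\underline v\in\mathbb{Z}^2}\frac{q^{h(\underline v)}-q^{h(\underline v+\underline 1)}}{1-q}\,t_1^{v_1}t_2^{v_2}.$$ Here the product of the numerator $(t_1-1)(t_2-1)$ with the sum over $\mathbb{Z}^2$ is taken coefficientwise; it has only nonnegative exponents, and it is then divided by $t_1t_2-1$ in $\mathbb{Z}[q][[t_1,t_2]]$. -/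

import Mathlib

open scoped LinearAlgebra.Projectivization

noncomputable section

namespace MotivicPoincare

/-! ### Quasi-projective complex varieties and their Grothendieck ring -/

/-- Zariski closed subsets of the complex projective space with homogeneous coordinates indexed by
`σ`: zero loci of sets of homogeneous polynomials. -/
def IsZariskiClosed {σ : Type} (A : Set (ℙ ℂ (σ → ℂ))) : Prop :=
  ∃ S : Set (MvPolynomial σ ℂ), (∀ F ∈ S, ∃ d : ℕ, F.IsHomogeneous d) ∧
    A = {p | ∀ F ∈ S, MvPolynomial.eval p.rep F = 0}

/-- Locally closed subsets of projective space. -/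
def IsLocClosed {σ : Type} (A : Set (ℙ ℂ (σ → ℂ))) : Prop :=
  ∃ Z W : Set (ℙ ℂ (σ → ℂ)), IsZariskiClosed Z ∧ IsZariskiClosed W ∧ A = Z \ W

/-- A quasi-projective complex variety: a locally closed subset of a projective space. -/
structure QPVar where
  /-- the index type of the homogeneous coordinates -/
  σ : Type
  finite : Finite σ
  /-- the set of points -/
  carrier : Set (ℙ ℂ (σ → ℂ))
  locClosed : IsLocClosed carrier

/-- Regular maps between quasi-projective varieties: locally given by homogeneous polynomials of
one and the same degree. -/
def IsRegular (V W : QPVar) (f : V.carrier → W.carrier) : Prop :=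
  ∀ x : V.carrier, ∃ (d : ℕ) (F : W.σ → MvPolynomial V.σ ℂ),
    (∀ j, (F j).IsHomogeneous d) ∧
    (fun j => MvPolynomial.eval x.1.rep (F j)) ≠ 0 ∧
    ∀ (y : V.carrier) (hy : (fun j => MvPolynomial.eval y.1.rep (F j)) ≠ 0),
      (f y).1 = Projectivization.mk ℂ (fun j => MvPolynomial.eval y.1.rep (F j)) hy

/-- Isomorphic quasi-projective varieties. -/
def IsIsomorphic (V W : QPVar) : Prop :=
  ∃ e : V.carrier ≃ W.carrier, IsRegular V W e ∧ IsRegular W V e.symm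

/-- The product of two subsets of projective spaces, in the Segre embedding. -/
def segreProd {σ τ : Type} (A : Set (ℙ ℂ (σ → ℂ))) (B : Set (ℙ ℂ (τ → ℂ))) :
    Set (ℙ ℂ (σ × τ → ℂ)) :=
  {z | ∃ x ∈ A, ∃ y ∈ B, ∃ h : (fun ij : σ × τ => x.rep ij.1 * y.rep ij.2) ≠ 0,
    z = Projectivization.mk ℂ (fun ij : σ × τ => x.rep ij.1 * y.rep ij.2) h}

/-- The defining relations of the Grothendieck ring of varieties. The hypotheses that the pieces
and the product are locally closed always hold; they are there to form the generators. -/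
inductive K0Rel : MvPolynomial QPVar ℤ → MvPolynomial QPVar ℤ → Prop
  | iso (V W : QPVar) (h : IsIsomorphic V W) :
      K0Rel (MvPolynomial.X V) (MvPolynomial.X W)
  | scissor (σ : Type) (hσ : Finite σ) (A Z : Set (ℙ ℂ (σ → ℂ))) (hA : IsLocClosed A)
      (hZ : IsZariskiClosed Z) (h₁ : IsLocClosed (A ∩ Z)) (h₂ : IsLocClosed (A \ Z)) :
      K0Rel (MvPolynomial.X ⟨σ, hσ, A, hA⟩)
        (MvPolynomial.X ⟨σ, hσ, A ∩ Z, h₁⟩ + MvPolynomial.X ⟨σ, hσ, A \ Z, h₂⟩)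
  | prod (V W : QPVar) (hf : Finite (V.σ × W.σ)) (h : IsLocClosed (segreProd V.carrier W.carrier)) :
      K0Rel (MvPolynomial.X ⟨V.σ × W.σ, hf, segreProd V.carrier W.carrier, h⟩)
        (MvPolynomial.X V * MvPolynomial.X W)
  | point (V : QPVar) (h : ∃ p, V.carrier = {p}) : K0Rel (MvPolynomial.X V) 1

/-- The Grothendieck ring `K₀(Var_ℂ)` of quasi-projective complex varieties, presented as a
commutative ring by generators `[V]` and the relations above. -/
abbrev K0 : Type 1 := MvPolynomial QPVar ℤ ⧸ Ideal.ofRel K0Rel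

/-- The class `[V]` of a variety. -/
def K0.cls (V : QPVar) : K0 := Ideal.Quotient.mk _ (MvPolynomial.X V)

/-- The affine line, as a chart of the projective line. -/
def affineLine : QPVar where
  σ := Fin 2
  finite := inferInstance
  carrier := {p | p.rep 1 ≠ 0}
  locClosed := by
    refine ⟨Set.univ, {p | p.rep 1 = 0}, ⟨∅, by simp, by simp⟩,
      ⟨{MvPolynomial.X 1}, ?_, by simp⟩, ?_⟩
    · intro F hF
      rw [Set.mem_singleton_iff] at hF
      exact ⟨1, hF ▸ MvPolynomial.isHomogeneous_X ℂ 1⟩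
    · ext p
      simp

/-- The class `𝕃` of the affine line. -/
def lefschetz : K0 := K0.cls affineLine

/-- The ring `K₀(Var_ℂ)[𝕃⁻¹]`. -/
abbrev K0L : Type 1 := Localization.Away lefschetz

/-- The element `q = 𝕃⁻¹`. -/
def qL : K0L := IsLocalization.Away.invSelf lefschetz

/-! ### Germs of functions, arcs and orders -/

/-- Power series in finitely many variables that converge in a neighbourhood of the origin. -/
def IsConvergent {σ : Type} (f : MvPowerSeries σ ℂ) : Prop :=
  ∃ C R : ℝ, 0 < R ∧ ∀ d : σ →₀ ℕ, ‖MvPowerSeries.coeff d f‖ ≤ C * R ^ d.degree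

/-- The space `𝒪 = ℂ{x, y}` of germs of analytic functions at the origin of the plane, where
`x` and `y` are the variables `0` and `1`. -/
def germs : Submodule ℂ (MvPowerSeries (Fin 2) ℂ) where
  carrier := {f | IsConvergent f}
  zero_mem' := ⟨0, 1, one_pos, fun d => by simp⟩
  add_mem' := by
    rintro f g ⟨C, R, hR, hf⟩ ⟨D, S, hS, hg⟩
    refine ⟨|C| + |D|, max R S, lt_max_of_lt_left hR, fun d => ?_⟩
    have h1 : C * R ^ d.degree ≤ |C| * max R S ^ d.degree :=
      mul_le_mul (le_abs_self C) (pow_le_pow_left₀ hR.le (le_max_left _ _) _)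
        (by positivity) (abs_nonneg _)
    have h2 : D * S ^ d.degree ≤ |D| * max R S ^ d.degree :=
      mul_le_mul (le_abs_self D) (pow_le_pow_left₀ hS.le (le_max_right _ _) _)
        (by positivity) (abs_nonneg _)
    rw [map_add, add_mul]
    exact (norm_add_le _ _).trans (add_le_add ((hf d).trans h1) ((hg d).trans h2))
  smul_mem' := by
    rintro c f ⟨C, R, hR, hf⟩
    refine ⟨‖c‖ * C, R, hR, fun d => ?_⟩
    rw [MvPowerSeries.coeff_smul, norm_mul, mul_assoc]
    exact mul_le_mul_of_nonneg_left (hf d) (norm_nonneg c)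

/-- A nonconstant germ of an analytic map `(ℂ, 0) → (ℂ², 0)`, `t ↦ (x(t), y(t))`. -/
structure Arc where
  /-- the two coordinate functions -/
  coord : Fin 2 → PowerSeries ℂ
  conv : ∀ i, IsConvergent (coord i)
  zero : ∀ i, PowerSeries.constantCoeff (coord i) = 0
  nonconst : ∃ i, coord i ≠ 0

/-- The restriction `f(γ(t))` of a power series to an arc. -/
def Arc.pullback (γ : Arc) (f : MvPowerSeries (Fin 2) ℂ) : PowerSeries ℂ :=
  MvPowerSeries.subst (S := ℂ) (τ := Unit) γ.coord f

/-- `v_γ(f) = Ord₀ f(γ(t))`. -/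
def Arc.ord (γ : Arc) (f : MvPowerSeries (Fin 2) ℂ) : ℕ∞ := (γ.pullback f).order

/-- `γ` is a system of uniformisations of the branches of the plane curve germ `{F = 0}`: every
`γ i` lies on the curve, and every nonconstant arc on the curve is obtained from exactly one `γ i`
by a reparametrisation `ψ : (ℂ, 0) → (ℂ, 0)`. In other words, the `γ i` together form the
normalisation of the curve, so `γ i` are the uniformisations of its irreducible components, each
component occurring once. -/
def IsUniformization {r : ℕ} (F : MvPowerSeries (Fin 2) ℂ) (γ : Fin r → Arc) : Prop :=
  (∀ i, (γ i).pullback F = 0) ∧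
  ∀ δ : Arc, δ.pullback F = 0 →
    ∃! i, ∃ ψ : PowerSeries ℂ, IsConvergent ψ ∧ PowerSeries.constantCoeff ψ = 0 ∧
      ∀ k, δ.coord k = PowerSeries.subst ψ ((γ i).coord k)

/-! ### The motivic measure on the projectivisation of the space of germs -/

/-- The indices of the coefficients of an `m`-jet. -/
abbrev JetIndex (m : ℕ) : Type := {d : Fin 2 →₀ ℕ // d.degree ≤ m}

lemma finite_jetIndex (m : ℕ) : Finite (JetIndex m) :=
  (Finsupp.finite_of_degree_le (σ := Fin 2) m).to_subtype

/-- The `m`-jet of a germ; the space `j_m(𝒪)` of `m`-jets is `JetIndex m → ℂ`, of dimension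
`(m + 1)(m + 2)/2`. -/
def jet (m : ℕ) (f : germs) : JetIndex m → ℂ := fun d => MvPowerSeries.coeff d.1 f.1

/-- The preimage in `ℙ𝒪` of a set of lines in the space of `m`-jets. -/
def jetPreimage (m : ℕ) (Y : Set (ℙ ℂ (JetIndex m → ℂ))) : Set (ℙ ℂ germs) :=
  {p | ∃ h : jet m p.rep ≠ 0, Projectivization.mk ℂ (jet m p.rep) h ∈ Y}

/-- `HasMeasure A c`: the set `A ⊆ ℙ𝒪` is cylindric, i.e. the preimage of a constructible set `Y`
(a disjoint union of finitely many locally closed sets) in some `ℙ j_m(𝒪)`, and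
`c = [Y] · 𝕃 ^ (- dim ℙ j_m(𝒪))`. -/
def HasMeasure (A : Set (ℙ ℂ germs)) (c : K0L) : Prop :=
  ∃ (m k : ℕ) (Y : Fin k → Set (ℙ ℂ (JetIndex m → ℂ))) (hY : ∀ i, IsLocClosed (Y i)),
    Pairwise (fun i j => Disjoint (Y i) (Y j)) ∧
    A = jetPreimage m (⋃ i, Y i) ∧
    c = algebraMap K0 K0L (∑ i, K0.cls ⟨JetIndex m, finite_jetIndex m, Y i, hY i⟩) *
      qL ^ ((m + 1) * (m + 2) / 2 - 1)

/-- Cylindric subsets of `ℙ𝒪`. -/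
def IsCylindric (A : Set (ℙ ℂ germs)) : Prop := ∃ c, HasMeasure A c

open Classical in
/-- The motivic measure of a cylindric subset of `ℙ𝒪` (it does not depend on the presentation). -/
def motivicMeasure (A : Set (ℙ ℂ germs)) : K0L :=
  if h : IsCylindric A then h.choose else 0

/-- The set of all lines in `𝒪` on which `(v_1, …, v_r)` takes the value `v`. -/
def levelSet {r : ℕ} (γ : Fin r → Arc) (v : Fin r →₀ ℕ) : Set (ℙ ℂ germs) :=
  {p | ∀ i, (γ i).ord p.rep.1 = (v i : ℕ∞)}

/-- The motivic Poincaré series `P_g = ∫_{ℙ𝒪} t_1^{v_1} ⋯ t_r^{v_r} dμ`: its coefficient at `t^v`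
is the measure of the level set of `v` (and `t_i^∞ = 0`). -/
def motivicSeries {r : ℕ} (γ : Fin r → Arc) : MvPowerSeries (Fin r) K0L :=
  fun v => motivicMeasure (levelSet γ v)

/-! ### The series of the multi-index filtration -/

lemma Arc.hasSubst (γ : Arc) : MvPowerSeries.HasSubst (S := ℂ) (τ := Unit) γ.coord :=
  MvPowerSeries.hasSubst_of_constantCoeff_zero γ.zero

/-- The ideal `J_v = {f ∈ 𝒪 : v_i(f) ≥ v_i}`, as a subspace of `𝒪`, for `v ∈ ℤ^r`. -/
def filtration {r : ℕ} (γ : Fin r → Arc) (v : Fin r → ℤ) : Submodule ℂ germs where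
  carrier := {f | ∀ i, ((v i).toNat : ℕ∞) ≤ (γ i).ord f.1}
  zero_mem' := fun i => by
    have h : (γ i).pullback 0 = 0 := by
      rw [Arc.pullback, ← MvPowerSeries.coe_substAlgHom (γ i).hasSubst, map_zero]
    simp [Arc.ord, h]
  add_mem' := by
    intro f g hf hg i
    have h : (γ i).pullback (f.1 + g.1) = (γ i).pullback f.1 + (γ i).pullback g.1 :=
      MvPowerSeries.subst_add (γ i).hasSubst _ _
    have h' : ((f + g : germs)).1 = f.1 + g.1 := rfl
    rw [Arc.ord, h', h]
    exact (le_min (hf i) (hg i)).trans (PowerSeries.min_order_le_order_add _ _)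
  smul_mem' := by
    intro c f hf i
    have h : (γ i).pullback (c • f.1) = c • (γ i).pullback f.1 :=
      MvPowerSeries.subst_smul (γ i).hasSubst _ _
    have h' : ((c • f : germs)).1 = c • f.1 := rfl
    rw [Arc.ord, h', h]
    exact (hf i).trans PowerSeries.le_order_smul

/-- `h(v) = codim J_v`. -/
def codim {r : ℕ} (γ : Fin r → Arc) (v : Fin r → ℤ) : ℕ :=
  Module.finrank ℂ (germs ⧸ filtration γ v)

/-- The coefficient `(q^{h(v)} - q^{h(v+1)}) / (1 - q) = ∑_{h(v) ≤ k < h(v+1)} q^k ∈ ℤ[q]`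
of `t^v` in the series `L_g`. -/
def lCoeff {r : ℕ} (γ : Fin r → Arc) (v : Fin r → ℤ) : Polynomial ℤ :=
  ∑ k ∈ Finset.Ico (codim γ v) (codim γ (v + 1)), Polynomial.X ^ k

/-- The product `L_g · ∏ (t_i - 1)`. The series `L_g` extends infinitely in negative directions,
but the coefficients of the product vanish outside `ℕ^r`, since `J_v` does not change when a
negative `v_i` is replaced by `0`. -/
def lSeriesMul {r : ℕ} (γ : Fin r → Arc) : MvPowerSeries (Fin r) (Polynomial ℤ) :=
  fun v => ∑ I : Finset (Fin r),
    (-1) ^ (r - I.card) * lCoeff γ (fun i => (v i : ℤ) - if i ∈ I then 1 else 0)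

/-- The power series `L_g · ∏ (t_i - 1) / (t_1 ⋯ t_r - 1)` over `ℤ[q]`, with a formal variable
`q`. -/
def filtrationSeries {r : ℕ} (γ : Fin r → Arc) : MvPowerSeries (Fin r) (Polynomial ℤ) :=
  lSeriesMul γ * MvPowerSeries.invOfUnit (∏ i, MvPowerSeries.X i - 1) (-1)

/-! ### Reduction -/

/-- The reduced series `∏ (1 - q t_i) · P` of a series `P`. -/
def reduced {A : Type*} [CommRing A] {r : ℕ} (q : A) (P : MvPowerSeries (Fin r) A) :
    MvPowerSeries (Fin r) A :=
  (∏ i, (1 - MvPowerSeries.C q * MvPowerSeries.X i)) * P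

end MotivicPoincare

end

open scoped LinearAlgebra.Projectivization

noncomputable section

namespace MotivicPoincare

/-! ### Zariski closed and locally closed sets -/

/-! Up to order and reparametrisation the branches are `t ↦ (t, ± t ^ n)`
(`IsUniformization.exists_stdArc`), so both series depend only on the coefficients of `f(t, ± t ^
n)`. These are linear functionals of `f`. Below degree `n` the two branches give the same
functionals (`branchCoeff_eq_of_lt`); apart from this they are independent
(`pi_branchCoeff_surjective`). Every level set is thus described by independent linear forms
required to vanish and one or two required not to.

A stratum where `c` independent forms vanish and one more does not has measure `q ^ c`, since it is
an affine-space bundle over a point (`setClass_linPreimage`, `setClass_linearStratum`). Hence the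
set `v_1 = a, v_2 = b` has measure `q ^ (a + b - n) - q ^ (a + b - n + 1)` if `a, b ≥ n`, measure `q
^ a` if `a = b < n`, and is empty otherwise (`hasMeasure_stdArc_ord`). The same bundle statement
shows that the measure does not depend on the jet order used to compute it (`HasMeasure.unique`).

The sum over the quadrant `a, b ≥ n` is `(1 - q) q ^ n (t_1 t_2) ^ n` times a geometric series that
the factors `1 - q t_i` cancel; the finite diagonal sum remains, and expanding it gives the formula
(`reduced_poincareSeries`).

For the filtration, the second difference of `q ^ h` is `1 - q` times the same coefficient
(`branchCodim_second_difference`), and `L_g · ∏ (t_i - 1)` is the Poincaré series times `t_1 t_2 -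
1` (`IsUniformization.lSeriesMul_eq`). -/

lemma eval_smul_of_isHomogeneous {σ : Type} {F : MvPolynomial σ ℂ} {d : ℕ}
    (hF : F.IsHomogeneous d) (c : ℂ) (v : σ → ℂ) :
    MvPolynomial.eval (c • v) F = c ^ d * MvPolynomial.eval v F := by
  rw [MvPolynomial.eval_eq, MvPolynomial.eval_eq, Finset.mul_sum]
  refine Finset.sum_congr rfl fun e he => ?_
  have h : e.degree = d := by
    by_contra h
    exact MvPolynomial.mem_support_iff.1 he (hF.coeff_eq_zero h)
  simp only [Pi.smul_apply, smul_eq_mul, mul_pow, Finset.prod_mul_distrib, Finset.prod_pow_eq_pow_sum]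
  rw [← h, Finsupp.degree_apply]
  ring

lemma exists_rep_mk_eq_smul {V : Type*} [AddCommGroup V] [Module ℂ V] (v : V) (hv : v ≠ 0) :
    ∃ c : ℂ, c ≠ 0 ∧ (Projectivization.mk ℂ v hv).rep = c • v := by
  obtain ⟨a, ha⟩ := Projectivization.exists_smul_eq_mk_rep ℂ v hv
  exact ⟨a, a.ne_zero, ha.symm⟩

lemma mk_smul_eq {V : Type*} [AddCommGroup V] [Module ℂ V] {v : V} {c : ℂ}
    (hv : v ≠ 0) (h : c • v ≠ 0) : Projectivization.mk ℂ (c • v) h = Projectivization.mk ℂ v hv :=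
  (Projectivization.mk_eq_mk_iff' ℂ _ _ _ _).2 ⟨c, rfl⟩

/-- The zero locus in projective space of a set of polynomials. -/
def zeroLocus {σ : Type} (S : Set (MvPolynomial σ ℂ)) : Set (ℙ ℂ (σ → ℂ)) :=
  {p | ∀ F ∈ S, MvPolynomial.eval p.rep F = 0}

lemma mk_mem_zeroLocus {σ : Type} {S : Set (MvPolynomial σ ℂ)}
    (hS : ∀ F ∈ S, ∃ d : ℕ, F.IsHomogeneous d) (v : σ → ℂ) (hv : v ≠ 0) :
    Projectivization.mk ℂ v hv ∈ zeroLocus S ↔ ∀ F ∈ S, MvPolynomial.eval v F = 0 := by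
  obtain ⟨c, hc, h⟩ := exists_rep_mk_eq_smul v hv
  refine forall₂_congr fun F hF => ?_
  obtain ⟨d, hd⟩ := hS F hF
  rw [h, eval_smul_of_isHomogeneous hd, mul_eq_zero, or_iff_right (pow_ne_zero _ hc)]

lemma isZariskiClosed_zeroLocus {σ : Type} {S : Set (MvPolynomial σ ℂ)}
    (hS : ∀ F ∈ S, ∃ d : ℕ, F.IsHomogeneous d) : IsZariskiClosed (zeroLocus S) :=
  ⟨S, hS, rfl⟩

lemma isZariskiClosed_empty {σ : Type} : IsZariskiClosed (∅ : Set (ℙ ℂ (σ → ℂ))) :=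
  ⟨{1}, fun F hF => ⟨0, by rw [Set.mem_singleton_iff.1 hF]; exact MvPolynomial.isHomogeneous_one _ _⟩,
    by simp⟩

lemma IsZariskiClosed.inter {σ : Type} {A B : Set (ℙ ℂ (σ → ℂ))} (hA : IsZariskiClosed A)
    (hB : IsZariskiClosed B) : IsZariskiClosed (A ∩ B) := by
  obtain ⟨S, hS, rfl⟩ := hA
  obtain ⟨T, hT, rfl⟩ := hB
  refine ⟨S ∪ T, fun F hF => hF.elim (hS F) (hT F), ?_⟩
  ext p
  simp only [Set.mem_inter_iff, Set.mem_ofPred_eq, Set.mem_union, or_imp, forall_and]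

lemma IsZariskiClosed.union {σ : Type} {A B : Set (ℙ ℂ (σ → ℂ))} (hA : IsZariskiClosed A)
    (hB : IsZariskiClosed B) : IsZariskiClosed (A ∪ B) := by
  obtain ⟨S, hS, rfl⟩ := hA
  obtain ⟨T, hT, rfl⟩ := hB
  refine ⟨{H | ∃ F ∈ S, ∃ G ∈ T, H = F * G}, ?_, ?_⟩
  · rintro _ ⟨F, hF, G, hG, rfl⟩
    obtain ⟨d, hd⟩ := hS F hF
    obtain ⟨e, he⟩ := hT G hG
    exact ⟨d + e, hd.mul he⟩
  · ext p
    constructor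
    · rintro (h | h) _ ⟨F, hF, G, hG, rfl⟩
      · rw [map_mul, h F hF, zero_mul]
      · rw [map_mul, h G hG, mul_zero]
    · intro h
      by_contra h'
      simp only [Set.mem_union, Set.mem_ofPred_eq, not_or, not_forall] at h'
      obtain ⟨⟨F, hF, hF'⟩, G, hG, hG'⟩ := h'
      have := h _ ⟨F, hF, G, hG, rfl⟩
      rw [map_mul] at this
      exact (mul_ne_zero hF' hG') this

lemma IsZariskiClosed.isLocClosed {σ : Type} {A : Set (ℙ ℂ (σ → ℂ))} (hA : IsZariskiClosed A) :
    IsLocClosed A :=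
  ⟨A, ∅, hA, isZariskiClosed_empty, by simp⟩

lemma isLocClosed_empty {σ : Type} : IsLocClosed (∅ : Set (ℙ ℂ (σ → ℂ))) :=
  isZariskiClosed_empty.isLocClosed

lemma IsLocClosed.inter_closed {σ : Type} {A Z : Set (ℙ ℂ (σ → ℂ))} (hA : IsLocClosed A)
    (hZ : IsZariskiClosed Z) : IsLocClosed (A ∩ Z) := by
  obtain ⟨B, W, hB, hW, rfl⟩ := hA
  exact ⟨B ∩ Z, W, hB.inter hZ, hW, by ext; simp; tauto⟩

lemma IsLocClosed.diff_closed {σ : Type} {A Z : Set (ℙ ℂ (σ → ℂ))} (hA : IsLocClosed A)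
    (hZ : IsZariskiClosed Z) : IsLocClosed (A \ Z) := by
  obtain ⟨B, W, hB, hW, rfl⟩ := hA
  exact ⟨B, W ∪ Z, hB, hW.union hZ, by ext; simp; tauto⟩

lemma IsLocClosed.inter {σ : Type} {A B : Set (ℙ ℂ (σ → ℂ))} (hA : IsLocClosed A)
    (hB : IsLocClosed B) : IsLocClosed (A ∩ B) := by
  obtain ⟨Z, W, hZ, hW, rfl⟩ := hB
  rw [← Set.inter_sdiff_assoc]
  exact (hA.inter_closed hZ).diff_closed hW

/-! ### Preimages under linear maps -/

/-- The preimage of a set of lines under a linear map; lines in the kernel are excluded. -/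
def linPreimage {V W : Type*} [AddCommGroup V] [Module ℂ V] [AddCommGroup W] [Module ℂ W]
    (φ : V →ₗ[ℂ] W) (Y : Set (ℙ ℂ W)) : Set (ℙ ℂ V) :=
  {p | ∃ h : φ p.rep ≠ 0, Projectivization.mk ℂ (φ p.rep) h ∈ Y}

section
variable {U V W : Type*} [AddCommGroup U] [Module ℂ U] [AddCommGroup V] [Module ℂ V]
  [AddCommGroup W] [Module ℂ W]

lemma mk_mem_linPreimage (φ : V →ₗ[ℂ] W) (Y : Set (ℙ ℂ W)) (v : V) (hv : v ≠ 0) :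
    Projectivization.mk ℂ v hv ∈ linPreimage φ Y ↔
      ∃ h : φ v ≠ 0, Projectivization.mk ℂ (φ v) h ∈ Y := by
  obtain ⟨c, hc, h⟩ := exists_rep_mk_eq_smul v hv
  unfold linPreimage
  simp only [Set.mem_ofPred_eq, h, map_smul]
  constructor
  · rintro ⟨h1, h2⟩
    have h3 : φ v ≠ 0 := fun h => h1 (by rw [h, smul_zero])
    exact ⟨h3, by rwa [mk_smul_eq h3] at h2⟩
  · rintro ⟨h1, h2⟩
    exact ⟨smul_ne_zero hc h1, by rwa [mk_smul_eq h1]⟩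

lemma linPreimage_linPreimage (φ : U →ₗ[ℂ] V) (ψ : V →ₗ[ℂ] W) (Y : Set (ℙ ℂ W)) :
    linPreimage φ (linPreimage ψ Y) = linPreimage (ψ ∘ₗ φ) Y := by
  ext p
  constructor
  · rintro ⟨h1, h2⟩
    exact (mk_mem_linPreimage ψ Y _ _).1 h2
  · rintro ⟨h1, h2⟩
    have h3 : φ p.rep ≠ 0 := fun h => h1 (by rw [LinearMap.comp_apply, h, map_zero])
    exact ⟨h3, (mk_mem_linPreimage _ _ _ _).2 ⟨h1, h2⟩⟩

lemma linPreimage_empty (φ : V →ₗ[ℂ] W) : linPreimage φ ∅ = ∅ := by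
  ext p; simp [linPreimage]

lemma linPreimage_inter (φ : V →ₗ[ℂ] W) (A B : Set (ℙ ℂ W)) :
    linPreimage φ (A ∩ B) = linPreimage φ A ∩ linPreimage φ B := by
  ext p; simp only [linPreimage, Set.mem_ofPred_eq, Set.mem_inter_iff]
  exact ⟨fun ⟨h, a, b⟩ => ⟨⟨h, a⟩, h, b⟩, fun ⟨⟨h, a⟩, _, b⟩ => ⟨h, a, b⟩⟩

lemma linPreimage_diff (φ : V →ₗ[ℂ] W) (A B : Set (ℙ ℂ W)) :
    linPreimage φ (A \ B) = linPreimage φ A \ linPreimage φ B := by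
  ext p; simp only [linPreimage, Set.mem_ofPred_eq, Set.mem_sdiff]
  exact ⟨fun ⟨h, a, b⟩ => ⟨⟨h, a⟩, fun ⟨_, b'⟩ => b b'⟩,
    fun ⟨⟨h, a⟩, b⟩ => ⟨h, a, fun b' => b ⟨h, b'⟩⟩⟩

lemma linPreimage_iUnion {ι : Sort*} (φ : V →ₗ[ℂ] W) (A : ι → Set (ℙ ℂ W)) :
    linPreimage φ (⋃ i, A i) = ⋃ i, linPreimage φ (A i) := by
  ext p; simp only [linPreimage, Set.mem_ofPred_eq, Set.mem_iUnion]
  exact ⟨fun ⟨h, i, a⟩ => ⟨i, h, a⟩, fun ⟨i, h, a⟩ => ⟨h, i, a⟩⟩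

lemma linPreimage_disjoint (φ : V →ₗ[ℂ] W) {A B : Set (ℙ ℂ W)} (h : Disjoint A B) :
    Disjoint (linPreimage φ A) (linPreimage φ B) := by
  rw [Set.disjoint_iff_inter_eq_empty] at *
  rw [← linPreimage_inter, h, linPreimage_empty]

/-- Every line of the target lifts to the source. Applied to jet maps, this recovers a set of jets
from its preimage in the space of germs. -/
lemma linPreimage_injective {φ : V →ₗ[ℂ] W} (hφ : Function.Surjective φ) :
    Function.Injective (linPreimage φ) := by
  have key : ∀ A B : Set (ℙ ℂ W), linPreimage φ A = linPreimage φ B → A ⊆ B := by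
    intro A B h p hp
    induction p using Projectivization.ind with | _ w hw => ?_
    obtain ⟨v, rfl⟩ := hφ w
    have hv : v ≠ 0 := fun h => hw (by rw [h, map_zero])
    have h1 := (mk_mem_linPreimage φ A v hv).2 ⟨hw, hp⟩
    rw [h] at h1
    exact ((mk_mem_linPreimage φ B v hv).1 h1).2
  exact fun A B h => (key A B h).antisymm (key B A h.symm)

end

/-- Linear functionals are given by homogeneous polynomials of degree one. -/
lemma exists_linear_form {σ : Type} [Finite σ] (l : (σ → ℂ) →ₗ[ℂ] ℂ) :
    ∃ F : MvPolynomial σ ℂ, F.IsHomogeneous 1 ∧ ∀ v, MvPolynomial.eval v F = l v := by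
  classical
  cases nonempty_fintype σ
  refine ⟨∑ i, MvPolynomial.C (l (Pi.single i 1)) * MvPolynomial.X i, ?_, fun v => ?_⟩
  · exact MvPolynomial.IsHomogeneous.sum _ _ _ fun i _ => (MvPolynomial.isHomogeneous_X _ i).C_mul _
  · rw [LinearMap.pi_apply_eq_sum_univ l v]
    simp only [map_sum, map_mul, MvPolynomial.eval_C, MvPolynomial.eval_X, smul_eq_mul]
    refine Finset.sum_congr rfl fun i _ => ?_
    rw [mul_comm]
    congr 2
    ext j
    simp [Pi.single_apply, eq_comm]

lemma isZariskiClosed_linear {σ ι : Type} [Finite σ] (l : ι → (σ → ℂ) →ₗ[ℂ] ℂ) :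
    IsZariskiClosed {p : ℙ ℂ (σ → ℂ) | ∀ i, l i p.rep = 0} := by
  choose F hF h using fun i => exists_linear_form (l i)
  refine ⟨Set.range F, ?_, ?_⟩
  · rintro _ ⟨i, rfl⟩
    exact ⟨1, hF i⟩
  · ext p
    simp [h]

/-- Substituting linear forms into homogeneous equations keeps them homogeneous. The lines in the
kernel form a linear, hence closed, set, which joins the closed set to be removed. -/
lemma IsLocClosed.linPreimage {σ τ : Type} [Finite σ] {Y : Set (ℙ ℂ (τ → ℂ))}
    (hY : IsLocClosed Y) (φ : (σ → ℂ) →ₗ[ℂ] (τ → ℂ)) : IsLocClosed (linPreimage φ Y) := by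
  choose L hL hL' using fun j => exists_linear_form (LinearMap.proj j ∘ₗ φ)
  have hev : ∀ (v : σ → ℂ) (F : MvPolynomial τ ℂ),
      MvPolynomial.eval v (MvPolynomial.aeval L F) = MvPolynomial.eval (φ v) F := by
    intro v F
    have h := MvPolynomial.eval₂_comp_left (MvPolynomial.eval v) MvPolynomial.C L F
    rw [MvPolynomial.aeval_def, MvPolynomial.algebraMap_eq, h]
    have h1 : (MvPolynomial.eval v).comp MvPolynomial.C = RingHom.id ℂ := by ext; simp
    have h2 : (MvPolynomial.eval v) ∘ L = φ v := by ext j; simp [hL']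
    rw [h1, h2, MvPolynomial.eval₂_id]
  have hcl : ∀ S : Set (MvPolynomial τ ℂ), (∀ F ∈ S, ∃ d : ℕ, F.IsHomogeneous d) →
      IsZariskiClosed {p : ℙ ℂ (σ → ℂ) | ∀ F ∈ S, MvPolynomial.eval (φ p.rep) F = 0} := by
    intro S hS
    refine ⟨MvPolynomial.aeval L '' S, ?_, ?_⟩
    · rintro _ ⟨F, hF, rfl⟩
      obtain ⟨d, hd⟩ := hS F hF
      exact ⟨1 * d, hd.aeval L fun i => hL i⟩
    · ext p
      simp only [Set.mem_ofPred_eq, Set.forall_mem_image, hev]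
  obtain ⟨_, _, ⟨S, hS, rfl⟩, ⟨T, hT, rfl⟩, rfl⟩ := hY
  refine ⟨_, _, hcl S hS, (isZariskiClosed_linear fun j => LinearMap.proj j ∘ₗ φ).union (hcl T hT), ?_⟩
  ext p
  have hk : ∀ h : φ p.rep ≠ 0, Projectivization.mk ℂ (φ p.rep) h ∈ zeroLocus S \ zeroLocus T ↔
      (∀ F ∈ S, MvPolynomial.eval (φ p.rep) F = 0) ∧
        ¬ ∀ F ∈ T, MvPolynomial.eval (φ p.rep) F = 0 := fun h => by
    rw [Set.mem_sdiff, mk_mem_zeroLocus hS, mk_mem_zeroLocus hT]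
  have hz : (∀ j, (LinearMap.proj j ∘ₗ φ) p.rep = 0) ↔ φ p.rep = 0 := by
    simp [funext_iff]
  constructor
  · rintro ⟨h, h1⟩
    have h2 := (hk h).1 h1
    exact ⟨h2.1, fun h3 => h3.elim (fun h4 => h (hz.1 h4)) h2.2⟩
  · rintro ⟨h1, h2⟩
    rw [Set.mem_union, not_or] at h2
    have h : φ p.rep ≠ 0 := fun h => h2.1 (hz.2 h)
    exact ⟨h, (hk h).2 ⟨h1, h2.2⟩⟩

/-! ### Classes in the Grothendieck ring -/

open Classical in
/-- The class of a set of points in projective space, `0` if the set is not locally closed. -/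
def setClass {σ : Type} [hσ : Finite σ] (A : Set (ℙ ℂ (σ → ℂ))) : K0 :=
  if h : IsLocClosed A then K0.cls ⟨σ, hσ, A, h⟩ else 0

lemma setClass_eq {σ : Type} [hσ : Finite σ] {A : Set (ℙ ℂ (σ → ℂ))} (h : IsLocClosed A) :
    setClass A = K0.cls ⟨σ, hσ, A, h⟩ := dif_pos h

lemma K0.mk_eq {a b : MvPolynomial QPVar ℤ} (h : K0Rel a b) :
    (Ideal.Quotient.mk (Ideal.ofRel K0Rel) a) = Ideal.Quotient.mk _ b := by
  rw [Ideal.Quotient.eq]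
  exact Submodule.subset_span ⟨a, b, h, by simp⟩

section
variable {σ τ : Type} [hσ : Finite σ] [hτ : Finite τ]

lemma setClass_scissor {A Z : Set (ℙ ℂ (σ → ℂ))} (hA : IsLocClosed A) (hZ : IsZariskiClosed Z) :
    setClass A = setClass (A ∩ Z) + setClass (A \ Z) := by
  rw [setClass_eq hA, setClass_eq (hA.inter_closed hZ), setClass_eq (hA.diff_closed hZ)]
  exact (K0.mk_eq (.scissor σ hσ A Z hA hZ (hA.inter_closed hZ) (hA.diff_closed hZ))).trans
    (map_add _ _ _)

lemma setClass_empty : setClass (∅ : Set (ℙ ℂ (σ → ℂ))) = 0 := by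
  have h := setClass_scissor (σ := σ) isLocClosed_empty isZariskiClosed_empty
  simpa using h

lemma setClass_point {p : ℙ ℂ (σ → ℂ)} (h : IsLocClosed {p}) : setClass {p} = 1 := by
  rw [setClass_eq h]
  exact (K0.mk_eq (.point _ ⟨p, rfl⟩)).trans (map_one _)

lemma setClass_prod {A : Set (ℙ ℂ (σ → ℂ))} {B : Set (ℙ ℂ (τ → ℂ))} (hA : IsLocClosed A)
    (hB : IsLocClosed B) (h : IsLocClosed (segreProd A B)) :
    setClass (segreProd A B) = setClass A * setClass B := by
  rw [setClass_eq h, setClass_eq hA, setClass_eq hB]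
  exact (K0.mk_eq (.prod ⟨σ, hσ, A, hA⟩ ⟨τ, hτ, B, hB⟩ inferInstance h)).trans (map_mul _ _ _)

/-- Sets that correspond to each other under mutually inverse homogeneous polynomial maps have the
same class. -/
lemma setClass_congr {A : Set (ℙ ℂ (σ → ℂ))} {B : Set (ℙ ℂ (τ → ℂ))} (hA : IsLocClosed A)
    (hB : IsLocClosed B) {d e : ℕ} (F : τ → MvPolynomial σ ℂ) (G : σ → MvPolynomial τ ℂ)
    (hF : ∀ j, (F j).IsHomogeneous d) (hG : ∀ i, (G i).IsHomogeneous e)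
    (hAB : ∀ (v : σ → ℂ) (hv : v ≠ 0), Projectivization.mk ℂ v hv ∈ A →
      ∃ h : (fun j => MvPolynomial.eval v (F j)) ≠ 0,
        Projectivization.mk ℂ (fun j => MvPolynomial.eval v (F j)) h ∈ B)
    (hBA : ∀ (w : τ → ℂ) (hw : w ≠ 0), Projectivization.mk ℂ w hw ∈ B →
      ∃ h : (fun i => MvPolynomial.eval w (G i)) ≠ 0,
        Projectivization.mk ℂ (fun i => MvPolynomial.eval w (G i)) h ∈ A)
    (hGF : ∀ (v : σ → ℂ) (hv : v ≠ 0), Projectivization.mk ℂ v hv ∈ A →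
      ∃ c : ℂ, (fun i => MvPolynomial.eval (fun j => MvPolynomial.eval v (F j)) (G i)) = c • v)
    (hFG : ∀ (w : τ → ℂ) (hw : w ≠ 0), Projectivization.mk ℂ w hw ∈ B →
      ∃ c : ℂ, (fun j => MvPolynomial.eval (fun i => MvPolynomial.eval w (G i)) (F j)) = c • w) :
    setClass A = setClass B := by
  have rA : ∀ x : A, Projectivization.mk ℂ x.1.rep x.1.rep_nonzero ∈ A := fun x => by
    rw [Projectivization.mk_rep]; exact x.2
  have rB : ∀ x : B, Projectivization.mk ℂ x.1.rep x.1.rep_nonzero ∈ B := fun x => by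
    rw [Projectivization.mk_rep]; exact x.2
  let f : A → B := fun x => ⟨_, (hAB x.1.rep x.1.rep_nonzero (rA x)).choose_spec⟩
  let g : B → A := fun x => ⟨_, (hBA x.1.rep x.1.rep_nonzero (rB x)).choose_spec⟩
  have hgf : ∀ x, g (f x) = x := by
    intro x
    apply Subtype.ext
    -- The chosen representative of the image is only a multiple `k` of the polynomial value;
    -- homogeneity turns this into the harmless factor `k ^ e`.
    obtain ⟨k, hk, h1⟩ := exists_rep_mk_eq_smul _ (hAB x.1.rep x.1.rep_nonzero (rA x)).choose
    obtain ⟨c, hc⟩ := hGF x.1.rep x.1.rep_nonzero (rA x)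
    have h2 : (fun i => MvPolynomial.eval (f x).1.rep (G i)) = (k ^ e * c) • x.1.rep := by
      have h3 : (f x).1.rep = k • fun j => MvPolynomial.eval x.1.rep (F j) := h1
      rw [h3, mul_smul, ← hc]
      ext i
      rw [eval_smul_of_isHomogeneous (hG i)]
      rfl
    have h4 := (hBA (f x).1.rep (f x).1.rep_nonzero (rB (f x))).choose
    conv_rhs => rw [← Projectivization.mk_rep x.1]
    exact (Projectivization.mk_eq_mk_iff' ℂ _ _ h4 x.1.rep_nonzero).2 ⟨_, h2.symm⟩
  have hfg : ∀ x, f (g x) = x := by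
    intro x
    apply Subtype.ext
    obtain ⟨k, hk, h1⟩ := exists_rep_mk_eq_smul _ (hBA x.1.rep x.1.rep_nonzero (rB x)).choose
    obtain ⟨c, hc⟩ := hFG x.1.rep x.1.rep_nonzero (rB x)
    have h2 : (fun j => MvPolynomial.eval (g x).1.rep (F j)) = (k ^ d * c) • x.1.rep := by
      have h3 : (g x).1.rep = k • fun i => MvPolynomial.eval x.1.rep (G i) := h1
      rw [h3, mul_smul, ← hc]
      ext i
      rw [eval_smul_of_isHomogeneous (hF i)]
      rfl
    have h4 := (hAB (g x).1.rep (g x).1.rep_nonzero (rA (g x))).choose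
    conv_rhs => rw [← Projectivization.mk_rep x.1]
    exact (Projectivization.mk_eq_mk_iff' ℂ _ _ h4 x.1.rep_nonzero).2 ⟨_, h2.symm⟩
  rw [setClass_eq hA, setClass_eq hB]
  refine K0.mk_eq (.iso _ _ ⟨⟨f, g, hgf, hfg⟩, ?_, ?_⟩)
  · exact fun x => ⟨d, F, hF, (hAB x.1.rep x.1.rep_nonzero (rA x)).choose, fun y hy => rfl⟩
  · exact fun x => ⟨e, G, hG, (hBA x.1.rep x.1.rep_nonzero (rB x)).choose, fun y hy => rfl⟩

/-- The class is additive on finite partitions into locally closed sets. -/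
lemma setClass_eq_sum {ι : Type*} (s : Finset ι) (Y : ι → Set (ℙ ℂ (σ → ℂ)))
    (hY : ∀ i ∈ s, IsLocClosed (Y i)) (hd : ∀ i ∈ s, ∀ j ∈ s, i ≠ j → Disjoint (Y i) (Y j)) :
    ∀ A : Set (ℙ ℂ (σ → ℂ)), IsLocClosed A → A ⊆ ⋃ i ∈ s, Y i →
      setClass A = ∑ i ∈ s, setClass (A ∩ Y i) := by
  classical
  induction s using Finset.induction_on with
  | empty =>
    intro A hA h
    have : A = ∅ := by simpa using h
    rw [this, setClass_empty, Finset.sum_empty]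
  | insert k s hk ih =>
    intro A hA h
    have ih' := ih (fun i hi => hY i (Finset.mem_insert_of_mem hi))
      (fun i hi j hj => hd i (Finset.mem_insert_of_mem hi) j (Finset.mem_insert_of_mem hj))
    -- The piece `Y k = Z \ W` is only locally closed, so `A` is cut twice: into `A ∩ Z ∩ W`, `A ∩ Y
    -- k` and `A \ Z`. The outer two parts avoid `Y k` and are covered by the remaining pieces.
    obtain ⟨Z, W, hZ, hW, hk'⟩ := hY k (Finset.mem_insert_self _ _)
    have hcov : ∀ p ∈ A, p ∉ Y k → p ∈ ⋃ i ∈ s, Y i := by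
      intro p hp hpk
      have := h hp
      rw [Finset.set_biUnion_insert] at this
      exact this.resolve_left hpk
    have hdis : ∀ i ∈ s, ∀ p ∈ Y i, p ∈ Z → p ∈ W := by
      intro i hi p hp hpZ
      by_contra hpW
      refine Set.disjoint_left.1 (hd i (Finset.mem_insert_of_mem hi) k (Finset.mem_insert_self _ _)
        fun h => hk (h ▸ hi)) hp ?_
      rw [hk']
      exact ⟨hpZ, hpW⟩
    have hAZ := hA.inter_closed hZ
    rw [Finset.sum_insert hk, setClass_scissor hA hZ, setClass_scissor hAZ hW,
      ih' (A ∩ Z ∩ W) (hAZ.inter_closed hW)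
        (fun p hp => hcov p hp.1.1 (by rw [hk']; exact fun h => h.2 hp.2)),
      ih' (A \ Z) (hA.diff_closed hZ) (fun p hp => hcov p hp.1 (by rw [hk']; exact fun h => hp.2 h.1))]
    have h1 : ∀ i ∈ s, setClass (A ∩ Y i) =
        setClass (A ∩ Z ∩ W ∩ Y i) + setClass (A \ Z ∩ Y i) := by
      intro i hi
      rw [setClass_scissor (hA.inter (hY i (Finset.mem_insert_of_mem hi))) hZ]
      congr 2
      · ext p
        have := hdis i hi p
        simp only [Set.mem_inter_iff]
        tauto
      · ext p
        simp only [Set.mem_inter_iff, Set.mem_sdiff]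
        tauto
    rw [Finset.sum_congr rfl h1, Finset.sum_add_distrib, hk', Set.inter_sdiff_assoc]
    ring

/-- Both sums equal the sum over the common refinement by the sets `Y i ∩ Y' j`. -/
lemma sum_setClass_eq {k l : ℕ} {Y : Fin k → Set (ℙ ℂ (σ → ℂ))} {Y' : Fin l → Set (ℙ ℂ (σ → ℂ))}
    (hY : ∀ i, IsLocClosed (Y i)) (hY' : ∀ i, IsLocClosed (Y' i))
    (hd : Pairwise fun i j => Disjoint (Y i) (Y j))
    (hd' : Pairwise fun i j => Disjoint (Y' i) (Y' j)) (h : ⋃ i, Y i = ⋃ i, Y' i) :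
    ∑ i, setClass (Y i) = ∑ i, setClass (Y' i) := by
  have h1 : ∀ i, setClass (Y i) = ∑ j, setClass (Y i ∩ Y' j) := fun i =>
    setClass_eq_sum Finset.univ Y' (fun i _ => hY' i) (fun i _ j _ hij => hd' hij) _ (hY i) (by
      simpa [← h] using Set.subset_iUnion Y i)
  have h2 : ∀ j, setClass (Y' j) = ∑ i, setClass (Y i ∩ Y' j) := fun j => by
    rw [setClass_eq_sum Finset.univ Y (fun i _ => hY i) (fun i _ j _ hij => hd hij) _ (hY' j) (by
      simpa [h] using Set.subset_iUnion Y' j)]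
    simp only [Set.inter_comm]
  rw [Finset.sum_congr rfl fun i _ => h1 i, Finset.sum_comm, Finset.sum_congr rfl fun j _ => h2 j]

end

/-! ### Linear projections are affine bundles -/

/-- Frees the Segre product from chosen representatives: any scalar can be absorbed into the first
factor. -/
lemma mk_mem_segreProd {σ τ : Type} {A : Set (ℙ ℂ (σ → ℂ))} {B : Set (ℙ ℂ (τ → ℂ))}
    (u : σ × τ → ℂ) (hu : u ≠ 0) :
    Projectivization.mk ℂ u hu ∈ segreProd A B ↔
      ∃ (x : σ → ℂ) (hx : x ≠ 0) (y : τ → ℂ) (hy : y ≠ 0), Projectivization.mk ℂ x hx ∈ A ∧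
        Projectivization.mk ℂ y hy ∈ B ∧ ∀ i j, u (i, j) = x i * y j := by
  constructor
  · rintro ⟨x, hx, y, hy, h, he⟩
    obtain ⟨c, hc⟩ := (Projectivization.mk_eq_mk_iff' ℂ _ _ _ _).1 he
    have hcx : c • x.rep ≠ 0 := by
      refine smul_ne_zero (fun h0 => hu ?_) x.rep_nonzero
      rw [← hc, h0, zero_smul]
    refine ⟨c • x.rep, hcx, y.rep, y.rep_nonzero, ?_, ?_, fun i j => ?_⟩
    · rwa [mk_smul_eq x.rep_nonzero, Projectivization.mk_rep]
    · rwa [Projectivization.mk_rep]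
    · rw [← hc]
      simp [mul_assoc]
  · rintro ⟨x, hx, y, hy, hA, hB, h⟩
    obtain ⟨c, hc, hc'⟩ := exists_rep_mk_eq_smul x hx
    obtain ⟨d, hd, hd'⟩ := exists_rep_mk_eq_smul y hy
    have he : (fun ij : σ × τ => (Projectivization.mk ℂ x hx).rep ij.1 *
        (Projectivization.mk ℂ y hy).rep ij.2) = (c * d) • u := by
      ext ⟨i, j⟩
      simp only [hc', hd', Pi.smul_apply, smul_eq_mul, h]
      ring
    have hne : (fun ij : σ × τ => (Projectivization.mk ℂ x hx).rep ij.1 *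
        (Projectivization.mk ℂ y hy).rep ij.2) ≠ 0 := by
      rw [he]
      exact smul_ne_zero (mul_ne_zero hc hd) hu
    refine ⟨_, hA, _, hB, hne, ?_⟩
    rw [eq_comm]
    exact (Projectivization.mk_eq_mk_iff' ℂ _ _ _ _).2 ⟨c * d, he.symm⟩

/-- The affine line as a set of points of the projective line. -/
def affineChart : Set (ℙ ℂ (Fin 2 → ℂ)) := {p | p.rep 1 ≠ 0}

lemma isLocClosed_affineChart : IsLocClosed affineChart := affineLine.locClosed

lemma mk_mem_affineChart (y : Fin 2 → ℂ) (hy : y ≠ 0) :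
    Projectivization.mk ℂ y hy ∈ affineChart ↔ y 1 ≠ 0 := by
  obtain ⟨c, hc, h⟩ := exists_rep_mk_eq_smul y hy
  change (Projectivization.mk ℂ y hy).rep 1 ≠ 0 ↔ _
  rw [h, Pi.smul_apply, smul_ne_zero_iff_right hc]

lemma setClass_affineChart : setClass affineChart = lefschetz :=
  setClass_eq isLocClosed_affineChart

section
variable {σ τ : Type} [hσ : Finite σ] [hτ : Finite τ]

/-- The points are matrices with two columns, of rank one, whose column `1` is nonzero and
represents a point of `Y`. The rank condition is given by the minors in `S`, the column condition by
a linear preimage. -/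
lemma isLocClosed_segreProd_affineChart {Y : Set (ℙ ℂ (τ → ℂ))} (hY : IsLocClosed Y) :
    IsLocClosed (segreProd Y affineChart) := by
  let φ : (τ × Fin 2 → ℂ) →ₗ[ℂ] (τ → ℂ) := LinearMap.funLeft ℂ ℂ fun j => (j, 1)
  let S : Set (MvPolynomial (τ × Fin 2) ℂ) := Set.range fun jl : τ × τ =>
    MvPolynomial.X (jl.1, 0) * MvPolynomial.X (jl.2, 1) -
      MvPolynomial.X (jl.2, 0) * MvPolynomial.X (jl.1, 1)
  have hS : ∀ F ∈ S, ∃ d : ℕ, F.IsHomogeneous d := by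
    rintro _ ⟨jl, rfl⟩
    exact ⟨1 + 1, ((MvPolynomial.isHomogeneous_X _ _).mul (MvPolynomial.isHomogeneous_X _ _)).sub
      ((MvPolynomial.isHomogeneous_X _ _).mul (MvPolynomial.isHomogeneous_X _ _))⟩
  convert (hY.linPreimage φ).inter_closed (isZariskiClosed_zeroLocus hS) using 1
  ext p
  induction p using Projectivization.ind with | _ u hu => ?_
  have hS' : (∀ F ∈ S, MvPolynomial.eval u F = 0) ↔
      ∀ j l, u (j, 0) * u (l, 1) = u (l, 0) * u (j, 1) := by
    simp only [S, Set.forall_mem_range, Prod.forall, map_sub, map_mul, MvPolynomial.eval_X,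
      sub_eq_zero]
  rw [mk_mem_segreProd, Set.mem_inter_iff, mk_mem_linPreimage, mk_mem_zeroLocus hS, hS']
  constructor
  · rintro ⟨x, hx, y, hy, hxY, hyL, h⟩
    have hy1 := (mk_mem_affineChart y hy).1 hyL
    have hφ : φ u = y 1 • x := by
      ext j
      simp [φ, LinearMap.funLeft_apply, h, mul_comm]
    refine ⟨⟨by rw [hφ]; exact smul_ne_zero hy1 hx, ?_⟩, fun j l => by simp only [h]; ring⟩
    simp only [hφ]
    rwa [mk_smul_eq hx]
  · rintro ⟨⟨h1, h2⟩, h3⟩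
    obtain ⟨l, hl⟩ := Function.ne_iff.1 h1
    have hl : u (l, 1) ≠ 0 := hl
    have hne : (u (l, 1))⁻¹ • φ u ≠ 0 := smul_ne_zero (inv_ne_zero hl) h1
    have hy : (fun k => u (l, k)) ≠ 0 := fun h => hl (congrFun h 1)
    refine ⟨(u (l, 1))⁻¹ • φ u, hne, fun k => u (l, k), hy, ?_, ?_, fun j k => ?_⟩
    · rwa [mk_smul_eq h1]
    · rwa [mk_mem_affineChart]
    · have h4 : φ u j = u (j, 1) := rfl
      rw [Pi.smul_apply, h4, smul_eq_mul]
      fin_cases k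
      · have := h3 j l
        simp only [Fin.zero_eta] at this ⊢
        field_simp
        linear_combination this
      · simp only [Fin.mk_one]
        field_simp

/-- The projection that forgets one additional coordinate. -/
def forgetNone (τ : Type) : (Option τ → ℂ) →ₗ[ℂ] (τ → ℂ) := LinearMap.funLeft ℂ ℂ some

/-- Where `v i ≠ 0` the line bundle is trivial, with fibre coordinate `v none / v i`. -/
lemma setClass_forgetNone_of_chart {Y : Set (ℙ ℂ (τ → ℂ))} (hY : IsLocClosed Y) (i : τ)
    (hi : ∀ v (hv : v ≠ 0), Projectivization.mk ℂ v hv ∈ Y → v i ≠ 0) :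
    setClass (linPreimage (forgetNone τ) Y) = setClass Y * lefschetz := by
  have hP := isLocClosed_segreProd_affineChart hY
  rw [← setClass_affineChart, ← setClass_prod hY isLocClosed_affineChart hP]
  have hdrop : ∀ v j, forgetNone τ v j = v (some j) := fun _ _ => rfl
  -- Clearing the denominator gives the quadratic map to the products of `v j` with `(v none, v i)`.
  -- Its inverse reads `v none` from entry `(i, 0)` and `v j` from entry `(j, 1)`, up to the common
  -- factor `v i`.
  refine setClass_congr (d := 1 + 1) (e := 1) (hY.linPreimage _) hP
    (fun jk => MvPolynomial.X (some jk.1) * ![MvPolynomial.X none, MvPolynomial.X (some i)] jk.2)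
    (fun o => o.elim (MvPolynomial.X (i, 0)) fun j => MvPolynomial.X (j, 1)) ?_ ?_ ?_ ?_ ?_ ?_
  · rintro ⟨j, k⟩
    refine (MvPolynomial.isHomogeneous_X _ _).mul ?_
    fin_cases k <;> exact MvPolynomial.isHomogeneous_X _ _
  · rintro (_ | j) <;> exact MvPolynomial.isHomogeneous_X _ _
  · intro v hv h
    obtain ⟨h1, h2⟩ := (mk_mem_linPreimage _ _ _ _).1 h
    have h3 := hi _ _ h2
    have hne : (fun jk : τ × Fin 2 => MvPolynomial.eval v (MvPolynomial.X (some jk.1) *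
        ![MvPolynomial.X none, MvPolynomial.X (some i)] jk.2)) ≠ 0 := fun h => by
      have := congrFun h (i, 1)
      simp only [map_mul, MvPolynomial.eval_X, Matrix.cons_val_one, Pi.zero_apply, mul_self_eq_zero,
        Matrix.cons_val_fin_one] at this
      exact h3 this
    refine ⟨hne, (mk_mem_segreProd _ _).2 ⟨forgetNone τ v, h1, ![v none, v (some i)],
      fun h => h3 (congrFun h 1), h2, (mk_mem_affineChart _ _).2 h3, fun j k => ?_⟩⟩
    fin_cases k <;> simp [hdrop]
  · intro w hw h
    obtain ⟨x, hx, y, hy, hxY, hyL, h⟩ := (mk_mem_segreProd _ _).1 h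
    have hy1 := (mk_mem_affineChart y hy).1 hyL
    have h4 : forgetNone τ (fun o : Option τ => MvPolynomial.eval w
        (o.elim (MvPolynomial.X (i, 0)) fun j => MvPolynomial.X (j, 1))) = y 1 • x := by
      ext j
      simp [hdrop, h, mul_comm]
    have h5 : y 1 • x ≠ 0 := smul_ne_zero hy1 hx
    have hne : (fun o : Option τ => MvPolynomial.eval w
        (o.elim (MvPolynomial.X (i, 0)) fun j => MvPolynomial.X (j, 1))) ≠ 0 := fun h6 => by
      rw [h6, map_zero] at h4
      exact h5 h4.symm
    refine ⟨hne, (mk_mem_linPreimage _ _ _ _).2 ⟨h4 ▸ h5, ?_⟩⟩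
    simp only [h4]
    rwa [mk_smul_eq hx]
  · intro v hv _
    refine ⟨v (some i), ?_⟩
    ext (_ | j) <;> simp [mul_comm]
  · intro w hw h
    obtain ⟨x, hx, y, hy, hxY, hyL, h⟩ := (mk_mem_segreProd _ _).1 h
    refine ⟨x i * y 1, ?_⟩
    ext ⟨j, k⟩
    fin_cases k <;> simp [h] <;> ring

lemma setClass_forgetNone {Y : Set (ℙ ℂ (τ → ℂ))} (hY : IsLocClosed Y) :
    setClass (linPreimage (forgetNone τ) Y) = setClass Y * lefschetz := by
  classical
  cases nonempty_fintype τ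
  -- Induction on a set `s` of coordinates that never vanish simultaneously on `Y`: off the
  -- hyperplane of `i` the chart lemma applies, and on it the coordinate `i` can be dropped from
  -- `s`.
  have key : ∀ s : Finset τ, ∀ Y : Set (ℙ ℂ (τ → ℂ)), IsLocClosed Y →
      (∀ v (hv : v ≠ 0), Projectivization.mk ℂ v hv ∈ Y → ∃ i ∈ s, v i ≠ 0) →
      setClass (linPreimage (forgetNone τ) Y) = setClass Y * lefschetz := by
    intro s
    induction s using Finset.induction_on with
    | empty =>
      intro Y hY h
      have : Y = ∅ := by
        ext p
        induction p using Projectivization.ind with | _ v hv => ?_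
        simpa using h v hv
      rw [this, linPreimage_empty, setClass_empty, setClass_empty, zero_mul]
    | insert i s _ ih =>
      intro Y hY h
      let Z : Set (ℙ ℂ (τ → ℂ)) := zeroLocus {MvPolynomial.X i}
      let Z' : Set (ℙ ℂ (Option τ → ℂ)) := zeroLocus {MvPolynomial.X (some i)}
      have hom : ∀ (κ : Type) (k : κ), ∀ F ∈ ({MvPolynomial.X k} : Set (MvPolynomial κ ℂ)),
          ∃ d : ℕ, F.IsHomogeneous d := fun κ k F hF =>
        ⟨1, by rw [Set.mem_singleton_iff.1 hF]; exact MvPolynomial.isHomogeneous_X _ _⟩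
      have hZ : IsZariskiClosed Z := isZariskiClosed_zeroLocus (hom _ _)
      have hZ' : IsZariskiClosed Z' := isZariskiClosed_zeroLocus (hom _ _)
      have memZ : ∀ v (hv : v ≠ 0), Projectivization.mk ℂ v hv ∈ Z ↔ v i = 0 := fun v hv => by
        simp [Z, mk_mem_zeroLocus (hom _ _)]
      -- The hyperplane upstairs also contains the centre of the projection, so it agrees with the
      -- preimage of `Z` only over `Y`.
      have hZZ' : ∀ p, p ∈ linPreimage (forgetNone τ) Y → (p ∈ Z' ↔
          p ∈ linPreimage (forgetNone τ) Z) := by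
        intro p hp
        induction p using Projectivization.ind with | _ v hv => ?_
        obtain ⟨h1, h2⟩ := (mk_mem_linPreimage _ _ _ _).1 hp
        rw [mk_mem_linPreimage, mk_mem_zeroLocus (hom _ _)]
        simp only [memZ, h1, ne_eq, not_false_eq_true, exists_true_left, Set.mem_singleton_iff,
          forall_eq, MvPolynomial.eval_X]
        rfl
      rw [setClass_scissor (hY.linPreimage _) hZ', setClass_scissor hY hZ, add_mul,
        ← ih _ (hY.inter_closed hZ), ← setClass_forgetNone_of_chart (hY.diff_closed hZ) i]
      · rw [linPreimage_inter, linPreimage_diff]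
        congr 2
        · ext p
          exact and_congr_right fun h => hZZ' p h
        · ext p
          exact and_congr_right fun h => not_congr (hZZ' p h)
      · intro v hv h1 h2
        exact h1.2 ((memZ v hv).2 h2)
      · rintro v hv ⟨h1, h2⟩
        obtain ⟨j, hj, h3⟩ := h v hv h1
        rcases Finset.mem_insert.1 hj with rfl | hj
        · exact absurd ((memZ v hv).1 h2) h3
        · exact ⟨j, hj, h3⟩
  refine key Finset.univ Y hY fun v hv _ => ?_
  obtain ⟨i, hi⟩ := Function.ne_iff.1 hv
  exact ⟨i, Finset.mem_univ _, hi⟩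

lemma setClass_linEquiv (φ : (σ → ℂ) ≃ₗ[ℂ] (τ → ℂ)) {Y : Set (ℙ ℂ (τ → ℂ))}
    (hY : IsLocClosed Y) : setClass (linPreimage (φ : (σ → ℂ) →ₗ[ℂ] (τ → ℂ)) Y) = setClass Y := by
  choose F hF hF' using fun j =>
    exists_linear_form (LinearMap.proj j ∘ₗ (φ : (σ → ℂ) →ₗ[ℂ] (τ → ℂ)))
  choose G hG hG' using fun j =>
    exists_linear_form (LinearMap.proj j ∘ₗ (φ.symm : (τ → ℂ) →ₗ[ℂ] (σ → ℂ)))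
  have eF : ∀ v, (fun j => MvPolynomial.eval v (F j)) = φ v := fun v => funext fun j => hF' j v
  have eG : ∀ v, (fun j => MvPolynomial.eval v (G j)) = φ.symm v := fun v => funext fun j => hG' j v
  refine setClass_congr (hY.linPreimage _) hY F G hF hG ?_ ?_ ?_ ?_
  · intro v hv h
    simp only [eF]
    exact (mk_mem_linPreimage _ _ _ _).1 h
  · intro w hw h
    have hne : φ.symm w ≠ 0 := by simpa using hw
    simp only [eG]
    refine ⟨hne, (mk_mem_linPreimage _ _ _ _).2 ?_⟩
    simpa using ⟨hw, h⟩
  · exact fun v hv _ => ⟨1, by simp only [eF, eG]; simp⟩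
  · exact fun v hv _ => ⟨1, by simp only [eF, eG]; simp⟩

/-- The preimage of a locally closed set under a surjective linear map with kernel of dimension `r`
is a bundle with fibre the affine space of dimension `r`. -/
theorem setClass_linPreimage (r : ℕ) : ∀ {τ : Type} [Finite τ] (φ : (σ → ℂ) →ₗ[ℂ] (τ → ℂ)),
    Function.Surjective φ → Nat.card σ = Nat.card τ + r → ∀ {Y : Set (ℙ ℂ (τ → ℂ))},
    IsLocClosed Y → setClass (linPreimage φ Y) = setClass Y * lefschetz ^ r := by
  cases nonempty_fintype σ
  induction r with
  | zero =>
    intro τ _ φ hφ hc Y hY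
    cases nonempty_fintype τ
    have hinj : Function.Injective φ :=
      (LinearMap.injective_iff_surjective_of_finrank_eq_finrank (by
        simpa [Nat.card_eq_fintype_card] using hc)).2 hφ
    rw [pow_zero, mul_one, ← setClass_linEquiv (LinearEquiv.ofBijective φ ⟨hinj, hφ⟩) hY]
    rfl
  | succ r ih =>
    intro τ _ φ hφ hc Y hY
    cases nonempty_fintype τ
    have hninj : ¬ Function.Injective φ := fun h => by
      have := LinearMap.finrank_le_finrank_of_injective h
      simp only [Module.finrank_fintype_fun_eq_card, Nat.card_eq_fintype_card] at this hc
      omega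
    obtain ⟨k, hk, hk0⟩ : ∃ k, φ k = 0 ∧ k ≠ 0 := by
      by_contra! h
      exact hninj ((injective_iff_map_eq_zero φ).2 h)
    obtain ⟨i, hi⟩ := Function.ne_iff.1 hk0
    -- Since `k i ≠ 0` for a kernel vector `k`, adjoining the coordinate `i` to `φ` keeps
    -- surjectivity and lowers the kernel dimension by one. Then `φ` is `ψ` followed by forgetting
    -- that coordinate.
    let ψ : (σ → ℂ) →ₗ[ℂ] (Option τ → ℂ) :=
      LinearMap.pi fun o => o.elim (LinearMap.proj i) fun j => LinearMap.proj j ∘ₗ φ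
    have hψ : Function.Surjective ψ := by
      intro w
      obtain ⟨v, hv⟩ := hφ fun j => w (some j)
      refine ⟨v + ((w none - v i) / k i) • k, ?_⟩
      have hi : k i ≠ 0 := hi
      ext (_ | j)
      · simp only [ψ, LinearMap.pi_apply, Option.elim_none,
          LinearMap.proj_apply, Pi.add_apply, Pi.smul_apply, smul_eq_mul]
        field_simp
        ring
      · simp only [ψ, LinearMap.pi_apply, Option.elim_some, LinearMap.comp_apply, map_add, map_smul,
          hk, hv, LinearMap.proj_apply, Pi.zero_apply, smul_zero, add_zero]
    have h1 : φ = forgetNone τ ∘ₗ ψ := by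
      ext1; rfl
    rw [h1, ← linPreimage_linPreimage, ih ψ hψ (by
      simp only [Nat.card_eq_fintype_card, Fintype.card_option] at hc ⊢; omega) (hY.linPreimage _),
      setClass_forgetNone hY]
    ring

end

/-! ### Jets and the motivic measure -/

instance (m : ℕ) : Finite (JetIndex m) := finite_jetIndex m

/-- The `m`-jet as a linear map. -/
def jetMap (m : ℕ) : germs →ₗ[ℂ] (JetIndex m → ℂ) where
  toFun := jet m
  map_add' _ _ := rfl
  map_smul' _ _ := rfl

lemma isConvergent_of_finite_support {σ : Type} {f : MvPowerSeries σ ℂ} (s : Finset (σ →₀ ℕ))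
    (h : ∀ d ∉ s, MvPowerSeries.coeff d f = 0) : IsConvergent f := by
  refine ⟨∑ d ∈ s, ‖MvPowerSeries.coeff d f‖, 1, one_pos, fun d => ?_⟩
  rw [one_pow, mul_one]
  by_cases hd : d ∈ s
  · exact Finset.single_le_sum (f := fun d => ‖MvPowerSeries.coeff d f‖)
      (fun _ _ => norm_nonneg _) hd
  · rw [h d hd, norm_zero]
    exact Finset.sum_nonneg fun _ _ => norm_nonneg _

lemma isConvergent_coe {σ : Type} (p : MvPolynomial σ ℂ) :
    IsConvergent (p : MvPowerSeries σ ℂ) :=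
  isConvergent_of_finite_support p.support fun d hd => by simpa using hd

open Classical in
/-- The polynomial germ with a given `m`-jet. -/
def ofJet (m : ℕ) : (JetIndex m → ℂ) →ₗ[ℂ] germs where
  toFun y := ⟨fun d => if h : d.degree ≤ m then y ⟨d, h⟩ else 0,
    isConvergent_of_finite_support (Finsupp.finite_of_degree_le (σ := Fin 2) m).toFinset
      fun d hd => dif_neg (by simpa using hd)⟩
  map_add' y z := by
    ext d
    change (if h : d.degree ≤ m then (y + z) ⟨d, h⟩ else 0) =
      (if h : d.degree ≤ m then y ⟨d, h⟩ else 0) + if h : d.degree ≤ m then z ⟨d, h⟩ else 0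
    split_ifs <;> simp
  map_smul' c y := by
    ext d
    change (if h : d.degree ≤ m then (c • y) ⟨d, h⟩ else 0) =
      c * if h : d.degree ≤ m then y ⟨d, h⟩ else 0
    split_ifs <;> simp

lemma jetMap_ofJet (m : ℕ) (y : JetIndex m → ℂ) : jetMap m (ofJet m y) = y :=
  funext fun d => dif_pos d.2

lemma jetMap_surjective (m : ℕ) : Function.Surjective (jetMap m) := fun y => ⟨_, jetMap_ofJet m y⟩

/-- Truncation of jets. -/
def truncJet {m m' : ℕ} (h : m ≤ m') : (JetIndex m' → ℂ) →ₗ[ℂ] (JetIndex m → ℂ) :=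
  LinearMap.funLeft ℂ ℂ fun d => ⟨d.1, d.2.trans h⟩

lemma truncJet_surjective {m m' : ℕ} (h : m ≤ m') : Function.Surjective (truncJet h) :=
  LinearMap.funLeft_surjective_of_injective _ _ _ fun _ _ hab =>
    Subtype.ext (Subtype.mk.inj hab)

lemma sum_range_sub (m : ℕ) : ∑ i ∈ Finset.range (m + 1), (m + 1 - i) = (m + 1) * (m + 2) / 2 := by
  suffices h : (∑ i ∈ Finset.range (m + 1), (m + 1 - i)) * 2 = (m + 1) * (m + 2) by omega
  induction m with
  | zero => rfl
  | succ m ih =>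
    rw [Finset.sum_range_succ', add_mul]
    simp only [Nat.add_sub_add_right]
    rw [ih]
    simp only [Nat.sub_zero]
    ring

lemma degree_fin_two (d : Fin 2 →₀ ℕ) : d.degree = d 0 + d 1 := by
  rw [Finsupp.degree_eq_sum, Fin.sum_univ_two]

lemma card_jetIndex (m : ℕ) : Nat.card (JetIndex m) = (m + 1) * (m + 2) / 2 := by
  rw [← sum_range_sub]
  let F : Finset (Σ _ : ℕ, ℕ) := (Finset.range (m + 1)).sigma fun i => Finset.range (m + 1 - i)
  have hF : F.card = ∑ i ∈ Finset.range (m + 1), (m + 1 - i) := by simp [F]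
  rw [← hF, ← Fintype.card_coe, ← Nat.card_eq_fintype_card]
  refine Nat.card_congr ⟨fun d => ⟨⟨d.1 0, d.1 1⟩, ?_⟩,
    fun p => ⟨Finsupp.equivFunOnFinite.symm ![p.1.1, p.1.2], ?_⟩, fun d => ?_, fun p => ?_⟩
  · have := d.2
    rw [degree_fin_two] at this
    simp only [F, Finset.mem_sigma, Finset.mem_range]
    omega
  · have := p.2
    simp only [F, Finset.mem_sigma, Finset.mem_range] at this
    simp only [degree_fin_two, Finsupp.equivFunOnFinite_symm_apply_apply, Matrix.cons_val_zero,
      Matrix.cons_val_one, Matrix.cons_val_fin_one]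
    omega
  · ext i
    fin_cases i <;> rfl
  · rfl

lemma pos_card_jetIndex (m : ℕ) : 0 < (m + 1) * (m + 2) / 2 :=
  Nat.div_pos (by nlinarith) two_pos

lemma jetPreimage_eq (m : ℕ) (Y : Set (ℙ ℂ (JetIndex m → ℂ))) :
    jetPreimage m Y = linPreimage (jetMap m) Y := rfl

/-! ### Independence of the measure from its presentation. -/

lemma algebraMap_lefschetz_mul_qL : algebraMap K0 K0L lefschetz * qL = 1 :=
  IsLocalization.Away.mul_invSelf lefschetz

lemma algebraMap_lefschetz_pow_mul_qL_pow (a b : ℕ) :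
    algebraMap K0 K0L lefschetz ^ a * qL ^ (a + b) = qL ^ b := by
  rw [pow_add, ← mul_assoc, ← mul_pow, algebraMap_lefschetz_mul_qL, one_pow, one_mul]

/-- Both presentations are compared in the higher jet space. Pulling back along truncation
multiplies classes by `𝕃 ^ r`, with `r` the difference of the jet dimensions, and the normalising
power of `q` compensates exactly. -/
lemma HasMeasure.unique_of_le {m m' k k' : ℕ} (hm : m ≤ m')
    {Y : Fin k → Set (ℙ ℂ (JetIndex m → ℂ))} (hY : ∀ i, IsLocClosed (Y i))
    (hd : Pairwise fun i j => Disjoint (Y i) (Y j))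
    {Y' : Fin k' → Set (ℙ ℂ (JetIndex m' → ℂ))} (hY' : ∀ i, IsLocClosed (Y' i))
    (hd' : Pairwise fun i j => Disjoint (Y' i) (Y' j))
    (h : jetPreimage m (⋃ i, Y i) = jetPreimage m' (⋃ i, Y' i)) :
    algebraMap K0 K0L (∑ i, setClass (Y i)) * qL ^ ((m + 1) * (m + 2) / 2 - 1) =
      algebraMap K0 K0L (∑ i, setClass (Y' i)) * qL ^ ((m' + 1) * (m' + 2) / 2 - 1) := by
  have h1 : ⋃ i, linPreimage (truncJet hm) (Y i) = ⋃ i, Y' i := by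
    apply linPreimage_injective (jetMap_surjective m')
    rw [← linPreimage_iUnion, linPreimage_linPreimage]
    exact h
  have hle : (m + 1) * (m + 2) / 2 ≤ (m' + 1) * (m' + 2) / 2 :=
    Nat.div_le_div_right (Nat.mul_le_mul (by omega) (by omega))
  obtain ⟨r, hr⟩ := Nat.exists_eq_add_of_le hle
  rw [← sum_setClass_eq (fun i => (hY i).linPreimage _) hY'
    (fun i j hij => linPreimage_disjoint _ (hd hij)) hd' h1]
  have h2 : ∀ i, setClass (linPreimage (truncJet hm) (Y i)) = setClass (Y i) * lefschetz ^ r :=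
    fun i => setClass_linPreimage r _ (truncJet_surjective hm)
      (by rw [card_jetIndex, card_jetIndex, hr]) (hY i)
  have h3 := pos_card_jetIndex m
  rw [Finset.sum_congr rfl fun i _ => h2 i, ← Finset.sum_mul, map_mul, map_pow, mul_assoc,
    show (m' + 1) * (m' + 2) / 2 - 1 = r + ((m + 1) * (m + 2) / 2 - 1) by omega,
    algebraMap_lefschetz_pow_mul_qL_pow]

lemma HasMeasure.unique {A : Set (ℙ ℂ germs)} {c c' : K0L} (h : HasMeasure A c)
    (h' : HasMeasure A c') : c = c' := by
  obtain ⟨m, k, Y, hY, hd, rfl, rfl⟩ := h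
  obtain ⟨m', k', Y', hY', hd', he, rfl⟩ := h'
  simp only [← setClass_eq]
  rcases le_total m m' with hm | hm
  · exact HasMeasure.unique_of_le hm hY hd hY' hd' he
  · exact (HasMeasure.unique_of_le hm hY' hd' hY hd he.symm).symm

lemma HasMeasure.motivicMeasure_eq {A : Set (ℙ ℂ germs)} {c : K0L} (h : HasMeasure A c) :
    motivicMeasure A = c := by
  have hA : IsCylindric A := ⟨c, h⟩
  rw [motivicMeasure, dif_pos hA]
  exact hA.choose_spec.unique h

lemma hasMeasure_empty : HasMeasure ∅ 0 :=
  ⟨0, 0, fun _ => ∅, fun _ => isLocClosed_empty, fun i => i.elim0,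
    by rw [jetPreimage_eq, Set.iUnion_of_empty, linPreimage_empty], by simp⟩

lemma hasMeasure_linPreimage_jetMap {m : ℕ} {Y : Set (ℙ ℂ (JetIndex m → ℂ))}
    (hY : IsLocClosed Y) : HasMeasure (linPreimage (jetMap m) Y)
      (algebraMap K0 K0L (setClass Y) * qL ^ ((m + 1) * (m + 2) / 2 - 1)) :=
  ⟨m, 1, fun _ => Y, fun _ => hY, fun i j hij => absurd (Subsingleton.elim i j) hij,
    by rw [jetPreimage_eq, Set.iUnion_const], by rw [Fin.sum_univ_one, setClass_eq hY]⟩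

/-! ### The standard arcs on the curve -/

lemma Arc.pullback_eq_substAlgHom (γ : Arc) (f : MvPowerSeries (Fin 2) ℂ) :
    γ.pullback f = MvPowerSeries.substAlgHom γ.hasSubst f := by
  rw [MvPowerSeries.coe_substAlgHom]; rfl

lemma Arc.pullback_coe (γ : Arc) (p : MvPolynomial (Fin 2) ℂ) :
    γ.pullback (p : MvPowerSeries (Fin 2) ℂ) = MvPolynomial.aeval γ.coord p :=
  MvPowerSeries.subst_coe p

/-- The sign of a branch. -/
def branchSign (b : Bool) : ℂ := if b then 1 else -1

lemma branchSign_sq (b : Bool) : branchSign b ^ 2 = 1 := by cases b <;> simp [branchSign]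

/-- The arcs `t ↦ (t, ± t ^ n)`. -/
def stdArc {n : ℕ} (hn : 1 ≤ n) (b : Bool) : Arc where
  coord := ![PowerSeries.X, PowerSeries.C (branchSign b) * PowerSeries.X ^ n]
  conv i := by
    fin_cases i
    · have h := isConvergent_coe (MvPolynomial.X () : MvPolynomial Unit ℂ)
      rwa [MvPolynomial.coe_X] at h
    · have h := isConvergent_coe (MvPolynomial.C (branchSign b) * MvPolynomial.X () ^ n)
      rwa [MvPolynomial.coe_mul, MvPolynomial.coe_pow, MvPolynomial.coe_X, MvPolynomial.coe_C] at h
  zero i := by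
    fin_cases i
    · simp
    · simp [show n ≠ 0 by omega]
  nonconst := ⟨0, PowerSeries.X_ne_zero⟩

section
variable {n : ℕ} (hn : 1 ≤ n)

@[simp] lemma stdArc_coord_zero (b : Bool) : (stdArc hn b).coord 0 = PowerSeries.X := rfl

@[simp] lemma stdArc_coord_one (b : Bool) :
    (stdArc hn b).coord 1 = PowerSeries.C (branchSign b) * PowerSeries.X ^ n := rfl

lemma stdArc_pullback_curve (b : Bool) :
    (stdArc hn b).pullback (MvPowerSeries.X 1 ^ 2 - MvPowerSeries.X 0 ^ (2 * n)) = 0 := by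
  simp only [Arc.pullback_eq_substAlgHom, map_sub, map_pow, MvPowerSeries.substAlgHom_X,
    stdArc_coord_zero, stdArc_coord_one]
  rw [mul_pow, ← map_pow, branchSign_sq, map_one, one_mul, ← pow_mul, mul_comm n, sub_self]

lemma stdArc_coeff_pullback (b : Bool) (f : MvPowerSeries (Fin 2) ℂ) (k : ℕ) :
    PowerSeries.coeff k ((stdArc hn b).pullback f) =
      ∑ᶠ d : Fin 2 →₀ ℕ, MvPowerSeries.coeff d f *
        if k = d 0 + n * d 1 then branchSign b ^ d 1 else 0 := by
  rw [Arc.pullback, PowerSeries.coeff, MvPowerSeries.coeff_subst (stdArc hn b).hasSubst]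
  refine finsum_congr fun d => ?_
  rw [smul_eq_mul]
  congr 1
  rw [Finsupp.prod_fintype _ _ (fun _ => pow_zero _), Fin.prod_univ_two, stdArc_coord_zero,
    stdArc_coord_one, mul_pow, mul_left_comm, ← pow_mul, ← pow_add, ← map_pow]
  exact (PowerSeries.coeff_C_mul_X_pow _ _ _)

/-- The functional `f ↦ a_k`, where `f(t, ± t ^ n) = ∑ a_k t ^ k`. -/
def branchCoeff (s : Bool × ℕ) : germs →ₗ[ℂ] ℂ where
  toFun f := PowerSeries.coeff s.2 ((stdArc hn s.1).pullback f.1)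
  map_add' f g := by
    simp only [Arc.pullback_eq_substAlgHom, Submodule.coe_add, map_add]
  map_smul' c f := by
    simp only [Arc.pullback_eq_substAlgHom, Submodule.coe_smul, map_smul, RingHom.id_apply]

lemma branchCoeff_apply (b : Bool) (k : ℕ) (f : germs) :
    branchCoeff hn (b, k) f = PowerSeries.coeff k ((stdArc hn b).pullback f.1) := rfl

/-- A monomial containing `y` has order at least `n` on either branch, so below degree `n` only
powers of `x` contribute. -/
lemma branchCoeff_eq_of_lt {k : ℕ} (hk : k < n) (b b' : Bool) (f : germs) :
    branchCoeff hn (b, k) f = branchCoeff hn (b', k) f := by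
  rw [branchCoeff_apply, branchCoeff_apply, stdArc_coeff_pullback, stdArc_coeff_pullback]
  refine finsum_congr fun d => ?_
  split_ifs with h
  · have : d 1 = 0 := by
      by_contra h1
      have := Nat.le_mul_of_pos_right n (Nat.pos_of_ne_zero h1)
      omega
    rw [this, pow_zero, pow_zero]
  · rfl

/-- Because `n ≥ 1`, the monomial `x ^ i y ^ j` has order `i + n j ≥ i + j` on a branch. Terms of
degree above `m` therefore cannot affect coefficients up to `m`, which makes the order conditions
cylindric. -/
lemma branchCoeff_ofJet {m : ℕ} {s : Bool × ℕ} (hs : s.2 ≤ m) (f : germs) :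
    branchCoeff hn s (ofJet m (jetMap m f)) = branchCoeff hn s f := by
  obtain ⟨b, k⟩ := s
  rw [branchCoeff_apply, branchCoeff_apply, stdArc_coeff_pullback, stdArc_coeff_pullback]
  refine finsum_congr fun d => ?_
  split_ifs with h
  · congr 1
    have hd : d.degree ≤ m := by
      rw [degree_fin_two]
      have := Nat.le_mul_of_pos_left (d 1) hn
      simp only at hs
      omega
    exact congrFun (jetMap_ofJet m (jetMap m f)) ⟨d, hd⟩
  · simp

/-- Polynomials that are dual to the coefficients along the branches. -/
def dualPoly (n : ℕ) (s : Bool × ℕ) : MvPolynomial (Fin 2) ℂ :=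
  if s.2 < n then MvPolynomial.X 0 ^ s.2 else
    MvPolynomial.C (1 / 2) * (MvPolynomial.X 0 ^ s.2 +
      MvPolynomial.C (branchSign s.1) * (MvPolynomial.X 0 ^ (s.2 - n) * MvPolynomial.X 1))

/-- The germs of the polynomials `dualPoly`. -/
def dualGerm (n : ℕ) (s : Bool × ℕ) : germs :=
  ⟨(dualPoly n s : MvPowerSeries (Fin 2) ℂ), isConvergent_coe _⟩

/-- The indices of the linearly independent coefficients along the branches. -/
def IsIndependentIndex (n : ℕ) (s : Bool × ℕ) : Prop := s.1 = true ∨ n ≤ s.2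

lemma branchCoeff_dualGerm {s s' : Bool × ℕ} (hs : IsIndependentIndex n s)
    (hs' : IsIndependentIndex n s') :
    branchCoeff hn s (dualGerm n s') = if s = s' then 1 else 0 := by
  obtain ⟨b, k⟩ := s
  obtain ⟨b', k'⟩ := s'
  rw [branchCoeff_apply]
  change PowerSeries.coeff k ((stdArc hn b).pullback (dualPoly n (b', k') : MvPowerSeries _ ℂ)) = _
  rw [Arc.pullback_coe, dualPoly]
  simp only [IsIndependentIndex] at hs hs'
  split_ifs with h1 h2 h2
  · simp only [Prod.mk.injEq] at h2
    simp [h2.2, PowerSeries.coeff_X_pow]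
  · simp only [map_pow, MvPolynomial.aeval_X, stdArc_coord_zero, PowerSeries.coeff_X_pow]
    rw [if_neg]
    rintro rfl
    refine h2 ?_
    simp only at h1
    have h3 : b = true := hs.resolve_right (by omega)
    have h4 : b' = true := hs'.resolve_right (by omega)
    rw [h3, h4]
  all_goals
    -- The factor `(1 + ε' ε) / 2` is `1` when the two signs agree and `0` when they differ, so this
    -- polynomial isolates one branch.
    have h3 : MvPolynomial.aeval (stdArc hn b).coord
        (MvPolynomial.C (1 / 2) * (MvPolynomial.X 0 ^ k' +
          MvPolynomial.C (branchSign b') * (MvPolynomial.X 0 ^ (k' - n) * MvPolynomial.X 1))) =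
        PowerSeries.C (1 / 2 * (1 + branchSign b' * branchSign b)) * PowerSeries.X ^ k' := by
      simp only [map_mul, map_add, map_pow, MvPolynomial.aeval_X, MvPolynomial.aeval_C,
        stdArc_coord_zero, stdArc_coord_one, map_one, ← PowerSeries.algebraMap_eq]
      have h4 : (PowerSeries.X : PowerSeries ℂ) ^ k' =
          PowerSeries.X ^ (k' - n) * PowerSeries.X ^ n := by
        rw [← pow_add, Nat.sub_add_cancel (by simpa using h1)]
      rw [h4]
      ring
    simp only
    rw [h3, PowerSeries.coeff_C_mul_X_pow]
  · simp only [Prod.mk.injEq] at h2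
    rw [if_pos h2.2, h2.1, ← sq, branchSign_sq]
    norm_num
  · split_ifs with h5
    · have h6 : b ≠ b' := fun h6 => h2 (by rw [h5, h6])
      cases b <;> cases b' <;> simp_all [branchSign]
    · rfl

/-- Linear combinations of the dual germs attain all prescribed values. This surjectivity is the
form of independence needed both for classes of strata and for codimensions. -/
lemma pi_branchCoeff_surjective (S : Finset (Bool × ℕ)) (hS : ∀ s ∈ S, IsIndependentIndex n s) :
    Function.Surjective (LinearMap.pi fun s : S => branchCoeff hn s.1) := by
  classical
  intro c
  refine ⟨∑ s : S, c s • dualGerm n s.1, ?_⟩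
  ext s
  rw [LinearMap.pi_apply, map_sum, Finset.sum_eq_single s]
  · rw [map_smul, branchCoeff_dualGerm hn (hS _ s.2) (hS _ s.2), if_pos rfl, smul_eq_mul, mul_one]
  · intro s' _ h
    rw [map_smul, branchCoeff_dualGerm hn (hS _ s.2) (hS _ s'.2),
      if_neg fun h' => h (Subtype.ext h'.symm), smul_zero]
  · exact fun h => absurd (Finset.mem_univ _) h

lemma le_stdArc_ord_iff (b : Bool) (a : ℕ) (f : germs) :
    (a : ℕ∞) ≤ (stdArc hn b).ord f.1 ↔ ∀ k < a, branchCoeff hn (b, k) f = 0 := by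
  constructor
  · intro h k hk
    exact PowerSeries.coeff_of_lt_order k (lt_of_lt_of_le (by exact_mod_cast hk) h)
  · exact fun h => PowerSeries.nat_le_order _ _ h

lemma stdArc_ord_eq_iff (b : Bool) (a : ℕ) (f : germs) :
    (stdArc hn b).ord f.1 = a ↔
      (∀ k < a, branchCoeff hn (b, k) f = 0) ∧ branchCoeff hn (b, a) f ≠ 0 := by
  rw [Arc.ord, PowerSeries.order_eq_nat, and_comm]
  rfl

end

/-! ### Reduction to the standard arcs -/

/-- Write `f = X ^ d * u` with `u` of nonzero constant term. Substitution preserves that constant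
term and sends `X ^ d` to `ψ ^ d`, of order `d`. -/
lemma order_subst_eq_of_order_eq_one {ψ : PowerSeries ℂ} (hψ : ψ.order = 1) (f : PowerSeries ℂ) :
    PowerSeries.order (PowerSeries.subst ψ f) = f.order := by
  have h0 : PowerSeries.constantCoeff ψ = 0 := by
    rw [← PowerSeries.order_ne_zero_iff_constCoeff_eq_zero, hψ]
    exact one_ne_zero
  have hs : PowerSeries.HasSubst ψ := PowerSeries.HasSubst.of_constantCoeff_zero' h0
  by_cases hf : f = 0
  · rw [hf, ← PowerSeries.coe_substAlgHom hs, map_zero]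
  let u := f.divXPowOrder
  have hu0 : PowerSeries.constantCoeff u ≠ 0 := fun h =>
    hf (PowerSeries.constantCoeff_divXPowOrder_eq_zero_iff.1 h)
  have h1 : PowerSeries.constantCoeff (PowerSeries.subst ψ u) ≠ 0 := by
    have h2 := PowerSeries.constantCoeff_subst_eq_zero (a := ψ) h0
      (u - PowerSeries.C (PowerSeries.constantCoeff u)) (by simp)
    rw [PowerSeries.subst_sub hs, PowerSeries.subst_C, map_sub] at h2
    rw [sub_eq_zero] at h2
    intro h3
    apply hu0
    have h4 : PowerSeries.constantCoeff (PowerSeries.subst ψ u) = _ := h2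
    rw [h3] at h4
    simpa using h4.symm
  have h2 : PowerSeries.order (PowerSeries.subst ψ u) = 0 := by
    by_contra h
    exact h1 (PowerSeries.order_ne_zero_iff_constCoeff_eq_zero.1 h)
  conv_lhs => rw [← PowerSeries.X_pow_order_mul_divXPowOrder (f := f)]
  rw [PowerSeries.subst_mul hs, PowerSeries.subst_pow hs, PowerSeries.subst_X hs]
  change PowerSeries.order (ψ ^ f.order.toNat * PowerSeries.subst ψ u) = _
  rw [PowerSeries.order_mul, PowerSeries.order_pow, h2, hψ, add_zero, nsmul_one]
  exact PowerSeries.coe_toNat_order hf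

/-- The orders of `ψ` and of `γ.coord 0` are at least `1`, and their product is at most the order
`1` of `δ.coord 0`. Hence `ψ` has order `1` and preserves orders. -/
lemma ord_eq_of_reparametrization {γ δ : Arc} {ψ : PowerSeries ℂ}
    (h0 : PowerSeries.constantCoeff ψ = 0) (hδ : (δ.coord 0).order = 1)
    (h : ∀ k, δ.coord k = PowerSeries.subst ψ (γ.coord k)) (f : MvPowerSeries (Fin 2) ℂ) :
    γ.ord f = δ.ord f := by
  have hs : PowerSeries.HasSubst ψ := PowerSeries.HasSubst.of_constantCoeff_zero' h0
  have h1 : ψ.order * (γ.coord 0).order ≤ 1 := by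
    rw [← hδ, h 0]
    have := PowerSeries.le_order_subst ψ hs (γ.coord 0)
    rw [PowerSeries.order_eq_order (φ := PowerSeries.subst ψ (γ.coord 0)),
      PowerSeries.order_eq_order (φ := ψ)]
    exact this
  have h2 : 1 ≤ ψ.order :=
    Order.one_le_iff_ne_zero.2 (PowerSeries.order_ne_zero_iff_constCoeff_eq_zero.2 h0)
  have h3 : 1 ≤ (γ.coord 0).order :=
    Order.one_le_iff_ne_zero.2 (PowerSeries.order_ne_zero_iff_constCoeff_eq_zero.2 (γ.zero 0))
  have hψ : ψ.order = 1 := by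
    refine le_antisymm (le_trans ?_ h1) h2
    exact le_mul_of_one_le_right' h3
  have h4 : δ.pullback f = PowerSeries.subst ψ (γ.pullback f) := by
    rw [PowerSeries.subst_def, Arc.pullback, Arc.pullback,
      MvPowerSeries.subst_comp_subst_apply γ.hasSubst hs.const]
    congr 1
    exact funext h
  rw [Arc.ord, Arc.ord, h4, order_subst_eq_of_order_eq_one hψ]

/-- The uniformisations are the standard arcs up to order and reparametrisation. -/
lemma IsUniformization.exists_stdArc {n : ℕ} (hn : 1 ≤ n) {γ : Fin 2 → Arc}
    (hγ : IsUniformization (MvPowerSeries.X 1 ^ 2 - MvPowerSeries.X 0 ^ (2 * n)) γ) :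
    ∃ i j : Fin 2, i ≠ j ∧ (∀ f, (γ i).ord f = (stdArc hn true).ord f) ∧
      ∀ f, (γ j).ord f = (stdArc hn false).ord f := by
  have key : ∀ b, ∃ i, ∀ f, (γ i).ord f = (stdArc hn b).ord f := by
    intro b
    obtain ⟨i, ⟨ψ, _, h0, h⟩, _⟩ := hγ.2 (stdArc hn b) (stdArc_pullback_curve hn b)
    exact ⟨i, ord_eq_of_reparametrization h0 (by simp) h⟩
  obtain ⟨i, hi⟩ := key true
  obtain ⟨j, hj⟩ := key false
  refine ⟨i, j, ?_, hi, hj⟩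
  rintro rfl
  -- The function `y - x ^ n` separates the branches: it vanishes on one and restricts to `-2 t ^ n`
  -- on the other.
  have hp : ∀ b, (stdArc hn b).pullback (MvPowerSeries.X 1 - MvPowerSeries.X 0 ^ n) =
      PowerSeries.C (branchSign b - 1) * PowerSeries.X ^ n := by
    intro b
    simp only [Arc.pullback_eq_substAlgHom, map_sub, map_pow, MvPowerSeries.substAlgHom_X,
      stdArc_coord_zero, stdArc_coord_one, map_one]
    ring
  have h := (hi (MvPowerSeries.X 1 - MvPowerSeries.X 0 ^ n)).symm.trans (hj _)
  rw [Arc.ord, Arc.ord, hp, hp] at h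
  have h1 : branchSign true - 1 = 0 := by simp [branchSign]
  rw [h1, map_zero, zero_mul, PowerSeries.order_zero, eq_comm, PowerSeries.order_eq_top] at h
  have h2 := congrArg (PowerSeries.coeff n) h
  rw [PowerSeries.coeff_C_mul_X_pow, if_pos rfl] at h2
  norm_num [branchSign] at h2

/-! ### Sets cut out by linear forms -/

/-- The lines on which the forms `l s`, `s ∈ T`, vanish and `l i` does not. -/
def linearStratum {V ι : Type*} [AddCommGroup V] [Module ℂ V] (l : ι → V →ₗ[ℂ] ℂ) (T : Finset ι)
    (i : ι) : Set (ℙ ℂ V) := {p | (∀ s ∈ T, l s p.rep = 0) ∧ l i p.rep ≠ 0}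

section
variable {V W ι : Type*} [AddCommGroup V] [Module ℂ V] [AddCommGroup W] [Module ℂ W]

lemma mk_mem_linearStratum (l : ι → V →ₗ[ℂ] ℂ) (T : Finset ι) (i : ι) (v : V) (hv : v ≠ 0) :
    Projectivization.mk ℂ v hv ∈ linearStratum l T i ↔ (∀ s ∈ T, l s v = 0) ∧ l i v ≠ 0 := by
  obtain ⟨c, hc, h⟩ := exists_rep_mk_eq_smul v hv
  simp only [linearStratum, Set.mem_ofPred_eq, h, map_smul, smul_eq_mul, mul_eq_zero, hc, false_or,
    ne_eq]

lemma linPreimage_linearStratum (φ : V →ₗ[ℂ] W) (l : ι → W →ₗ[ℂ] ℂ) (T : Finset ι) (i : ι) :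
    linPreimage φ (linearStratum l T i) = linearStratum (fun s => l s ∘ₗ φ) T i := by
  ext p
  constructor
  · rintro ⟨h1, h2⟩
    exact (mk_mem_linearStratum l T i _ _).1 h2
  · intro h
    have h1 : φ p.rep ≠ 0 := fun h1 => h.2 (by rw [LinearMap.comp_apply, h1, map_zero])
    exact ⟨h1, (mk_mem_linearStratum _ _ _ _ _).2 h⟩

end

section
variable {σ : Type} [hσ : Finite σ] {ι : Type}

lemma isLocClosed_linearStratum (l : ι → (σ → ℂ) →ₗ[ℂ] ℂ) (T : Finset ι) (i : ι) :
    IsLocClosed (linearStratum l T i) := by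
  convert (isZariskiClosed_linear fun s : T => l s.1).isLocClosed.diff_closed
    (isZariskiClosed_linear fun _ : Unit => l i) using 1
  ext p
  simp [linearStratum]

variable [DecidableEq ι]

/-- The forms indexed by `insert i T` map the stratum onto a single point of projective space, the
`i`-th coordinate point. The stratum is its full linear preimage, so the bundle formula applies. -/
lemma setClass_linearStratum {l : ι → (σ → ℂ) →ₗ[ℂ] ℂ} {T : Finset ι} {i : ι} (hi : i ∉ T)
    (hl : Function.Surjective (LinearMap.pi fun s : (insert i T : Finset ι) => l s.1)) {r : ℕ}
    (hr : Nat.card σ = T.card + 1 + r) :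
    setClass (linearStratum l T i) = lefschetz ^ r := by
  let I : (insert i T : Finset ι) := ⟨i, Finset.mem_insert_self _ _⟩
  have hne : (Pi.single I 1 : ↥(insert i T) → ℂ) ≠ 0 := by simp
  let P : ℙ ℂ (↥(insert i T) → ℂ) := Projectivization.mk ℂ _ hne
  have hP : ∀ v (hv : v ≠ 0), Projectivization.mk ℂ v hv = P ↔ (∀ s, s ≠ I → v s = 0) := by
    intro v hv
    rw [Projectivization.mk_eq_mk_iff']
    constructor
    · rintro ⟨c, rfl⟩ s hs
      simp [hs]
    · intro h
      refine ⟨v I, ?_⟩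
      ext s
      by_cases hs : s = I
      · simp [hs]
      · simp [hs, h s hs]
  have hcl : IsLocClosed {P} := by
    convert (isZariskiClosed_linear (σ := (insert i T : Finset ι))
      fun s : {s : (insert i T : Finset ι) // s ≠ I} => LinearMap.proj s.1).isLocClosed using 1
    ext p
    have := hP p.rep p.rep_nonzero
    rw [Projectivization.mk_rep] at this
    rw [Set.mem_singleton_iff, this]
    simp
  have heq : linearStratum l T i =
      linPreimage (LinearMap.pi fun s : (insert i T : Finset ι) => l s.1) {P} := by
    ext p
    constructor
    · rintro ⟨h1, h2⟩
      refine ⟨fun h => h2 (congrFun h I), (hP _ _).2 ?_⟩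
      rintro ⟨s, hs⟩ hsI
      refine h1 s ((Finset.mem_insert.1 hs).resolve_left fun h => hsI (Subtype.ext h))
    · rintro ⟨h1, h2⟩
      have h3 := (hP _ _).1 h2
      have h4 : ∀ s ∈ T, l s p.rep = 0 := fun s hs =>
        h3 ⟨s, Finset.mem_insert_of_mem hs⟩ fun h => hi (by
          rwa [← show s = i from congrArg Subtype.val h])
      refine ⟨h4, fun h => h1 ?_⟩
      ext ⟨s, hs⟩
      rcases Finset.mem_insert.1 hs with rfl | hs
      · exact h
      · exact h4 s hs
  rw [heq, setClass_linPreimage r _ hl _ hcl, setClass_point hcl, one_mul]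
  rw [hr, Nat.card_eq_fintype_card, Fintype.card_coe, Finset.card_insert_of_notMem hi]

/-- Cuts along the hyperplane of `l j`; `linearStratum l ∅ j` encodes the single condition that `l
j` does not vanish. -/
lemma setClass_linearStratum_add {l : ι → (σ → ℂ) →ₗ[ℂ] ℂ} {T : Finset ι} {i j : ι} :
    setClass (linearStratum l T i) = setClass (linearStratum l (insert j T) i) +
      setClass (linearStratum l T i ∩ linearStratum l ∅ j) := by
  have hZ := isZariskiClosed_linear fun _ : Unit => l j
  rw [setClass_scissor (isLocClosed_linearStratum l T i) hZ]
  congr 2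
  · ext p
    simp only [linearStratum, Set.mem_inter_iff, Set.mem_ofPred_eq, forall_const,
      Finset.mem_insert, forall_eq_or_imp]
    tauto
  · ext p
    simp [linearStratum]

end

lemma card_le_of_surjective {σ : Type} [Finite σ] {ι : Type} {S : Finset ι}
    {φ : (σ → ℂ) →ₗ[ℂ] (S → ℂ)} (h : Function.Surjective φ) : S.card ≤ Nat.card σ := by
  cases nonempty_fintype σ
  have := LinearMap.finrank_le_finrank_of_surjective h
  simpa [Nat.card_eq_fintype_card] using this

/-! ### The measure of the level sets -/

section
variable {n : ℕ} (hn : 1 ≤ n)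

/-- The functionals `branchCoeff` on jets. -/
def jetBranchCoeff (m : ℕ) (s : Bool × ℕ) : (JetIndex m → ℂ) →ₗ[ℂ] ℂ :=
  branchCoeff hn s ∘ₗ ofJet m

lemma jetBranchCoeff_comp_jetMap {m : ℕ} {s : Bool × ℕ} (hs : s.2 ≤ m) :
    jetBranchCoeff hn m s ∘ₗ jetMap m = branchCoeff hn s :=
  LinearMap.ext fun f => branchCoeff_ofJet hn hs f

lemma pi_jetBranchCoeff_surjective {m : ℕ} (S : Finset (Bool × ℕ))
    (hS : ∀ s ∈ S, IsIndependentIndex n s) (hm : ∀ s ∈ S, s.2 ≤ m) :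
    Function.Surjective (LinearMap.pi fun s : S => jetBranchCoeff hn m s.1) := by
  intro c
  obtain ⟨f, hf⟩ := pi_branchCoeff_surjective hn S hS c
  refine ⟨jetMap m f, ?_⟩
  rw [← hf]
  ext s
  exact branchCoeff_ofJet hn (hm s s.2) f

lemma linPreimage_jetMap_linearStratum {m : ℕ} {T : Finset (Bool × ℕ)} {i : Bool × ℕ}
    (hT : ∀ s ∈ T, s.2 ≤ m) (hi : i.2 ≤ m) :
    linPreimage (jetMap m) (linearStratum (jetBranchCoeff hn m) T i) =
      linearStratum (branchCoeff hn) T i := by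
  rw [linPreimage_linearStratum]
  ext p
  simp only [linearStratum, Set.mem_ofPred_eq]
  rw [jetBranchCoeff_comp_jetMap hn hi]
  refine and_congr_left fun _ => forall₂_congr fun s hs => ?_
  rw [jetBranchCoeff_comp_jetMap hn (hT s hs)]

/-- With `N` the dimension of the jet space, the class is `𝕃 ^ (N - 1 - |T|)`, and normalising by `q
^ (N - 1)` removes all dependence on `m`. -/
lemma setClass_linearStratum_jet {m : ℕ} {T : Finset (Bool × ℕ)} {i : Bool × ℕ}
    (hiT : i ∉ T) (hT : ∀ s ∈ insert i T, IsIndependentIndex n s)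
    (hm : ∀ s ∈ insert i T, s.2 ≤ m) :
    algebraMap K0 K0L (setClass (linearStratum (jetBranchCoeff hn m) T i)) *
      qL ^ ((m + 1) * (m + 2) / 2 - 1) = qL ^ T.card := by
  have h1 := pi_jetBranchCoeff_surjective hn _ hT hm
  have h2 := card_le_of_surjective h1
  rw [Finset.card_insert_of_notMem hiT] at h2
  obtain ⟨r, hr⟩ := Nat.exists_eq_add_of_le h2
  rw [setClass_linearStratum hiT h1 hr, map_pow]
  rw [card_jetIndex] at hr
  rw [show (m + 1) * (m + 2) / 2 - 1 = r + T.card by omega, algebraMap_lefschetz_pow_mul_qL_pow]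

lemma exists_jet_order (S : Finset (Bool × ℕ)) : ∃ m, ∀ s ∈ S, s.2 ≤ m :=
  ⟨S.sup Prod.snd, fun _ hs => Finset.le_sup (f := Prod.snd) hs⟩

lemma hasMeasure_linearStratum {T : Finset (Bool × ℕ)} {i : Bool × ℕ} (hiT : i ∉ T)
    (hT : ∀ s ∈ insert i T, IsIndependentIndex n s) :
    HasMeasure (linearStratum (branchCoeff hn) T i) (qL ^ T.card) := by
  obtain ⟨m, hm⟩ := exists_jet_order (insert i T)
  rw [← setClass_linearStratum_jet hn hiT hT hm, ← linPreimage_jetMap_linearStratum hn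
    (fun s hs => hm s (Finset.mem_insert_of_mem hs)) (hm i (Finset.mem_insert_self _ _))]
  exact hasMeasure_linPreimage_jetMap (isLocClosed_linearStratum _ _ _)

/-- Nonvanishing of two forms is obtained by subtraction: from the stratum with `i` nonvanishing,
remove the part where `j` joins the vanishing conditions. -/
lemma hasMeasure_linearStratum_inter {T : Finset (Bool × ℕ)} {i j : Bool × ℕ} (hiT : i ∉ T)
    (hjT : j ∉ T) (hij : i ≠ j) (hT : ∀ s ∈ insert i (insert j T), IsIndependentIndex n s) :
    HasMeasure (linearStratum (branchCoeff hn) T i ∩ linearStratum (branchCoeff hn) ∅ j)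
      (qL ^ T.card - qL ^ (T.card + 1)) := by
  obtain ⟨m, hm⟩ := exists_jet_order (insert i (insert j T))
  have hsub : ∀ s ∈ insert i T, s ∈ insert i (insert j T) := fun s hs =>
    Finset.insert_subset_insert _ (Finset.subset_insert _ _) hs
  have h1 := setClass_linearStratum_jet hn hiT (fun s hs => hT s (hsub s hs))
    (fun s hs => hm s (hsub s hs))
  have h2 := setClass_linearStratum_jet hn (T := insert j T) (i := i) (m := m)
    (by simp [hij, hiT]) hT hm
  rw [Finset.card_insert_of_notMem hjT] at h2
  rw [setClass_linearStratum_add (j := j), map_add, add_mul, h2] at h1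
  rw [← eq_sub_iff_add_eq'.2 h1, ← linPreimage_jetMap_linearStratum hn (m := m)
      (fun s hs => hm s (by simp [hs])) (hm i (by simp)),
    ← linPreimage_jetMap_linearStratum hn (T := ∅) (i := j) (m := m) (by simp) (hm j (by simp)),
    ← linPreimage_inter]
  exact hasMeasure_linPreimage_jetMap
    ((isLocClosed_linearStratum _ _ _).inter (isLocClosed_linearStratum _ _ _))

/-- The independent conditions for a germ to have order at least `a` and `b` on the branches. -/
def orderConditions (n a b : ℕ) : Finset (Bool × ℕ) :=
  (Finset.range (max a (min n b))).map ⟨fun k => (true, k), Prod.mk_right_injective _⟩ ∪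
    (Finset.Ico n b).map ⟨fun k => (false, k), Prod.mk_right_injective _⟩

lemma mem_orderConditions {n a b : ℕ} {s : Bool × ℕ} : s ∈ orderConditions n a b ↔
    s.1 = true ∧ s.2 < max a (min n b) ∨ s.1 = false ∧ n ≤ s.2 ∧ s.2 < b := by
  obtain ⟨c, k⟩ := s
  simp only [orderConditions, Finset.mem_union, Finset.mem_map, Finset.mem_range,
    Function.Embedding.coeFn_mk, Prod.mk.injEq, Finset.mem_Ico]
  constructor
  · rintro (⟨k', h, rfl, rfl⟩ | ⟨k', h, rfl, rfl⟩) <;> simp_all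
  · rintro (⟨rfl, h⟩ | ⟨rfl, h⟩)
    · exact Or.inl ⟨k, h, rfl, rfl⟩
    · exact Or.inr ⟨k, h, rfl, rfl⟩

/-- The codimension of the space of germs of order at least `a` and `b` on the branches. -/
def branchCodim (n a b : ℕ) : ℕ := max a (min n b) + (b - n)

lemma card_orderConditions (n a b : ℕ) : (orderConditions n a b).card = branchCodim n a b := by
  rw [orderConditions, Finset.card_union_of_disjoint, Finset.card_map, Finset.card_map,
    Finset.card_range, Nat.card_Ico, branchCodim]
  rw [Finset.disjoint_left]
  intro s h1 h2
  simp only [Finset.mem_map, Function.Embedding.coeFn_mk] at h1 h2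
  obtain ⟨k, _, rfl⟩ := h1
  obtain ⟨k', _, h⟩ := h2
  simp at h

lemma branchCodim_comm (n a b : ℕ) : branchCodim n a b = branchCodim n b a := by
  unfold branchCodim; omega

lemma isIndependentIndex_of_mem_orderConditions {a b : ℕ} {s : Bool × ℕ}
    (hs : s ∈ orderConditions n a b) : IsIndependentIndex n s := by
  rw [mem_orderConditions] at hs
  rcases hs with h | h
  · exact Or.inl h.1
  · exact Or.inr h.2.1

/-- Conditions in degrees below `n` are shared by the branches and are recorded on the `true` branch
only; this accounts for the bound `max a (min n b)`. The other branch contributes new conditions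
only from degree `n` on. -/
lemma forall_mem_orderConditions_iff {a b : ℕ} (f : germs) :
    (∀ s ∈ orderConditions n a b, branchCoeff hn s f = 0) ↔
      (a : ℕ∞) ≤ (stdArc hn true).ord f.1 ∧ (b : ℕ∞) ≤ (stdArc hn false).ord f.1 := by
  rw [le_stdArc_ord_iff, le_stdArc_ord_iff]
  simp only [mem_orderConditions]
  constructor
  · intro h
    refine ⟨fun k hk => h (true, k) (Or.inl ⟨rfl, by simp only; omega⟩), fun k hk => ?_⟩
    by_cases hkn : k < n
    · rw [branchCoeff_eq_of_lt hn hkn false true]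
      exact h (true, k) (Or.inl ⟨rfl, by simp only; omega⟩)
    · exact h (false, k) (Or.inr ⟨rfl, by simp only; omega⟩)
  · rintro ⟨h1, h2⟩ ⟨c, k⟩ (⟨rfl, h⟩ | ⟨rfl, h⟩)
    · by_cases hka : k < a
      · exact h1 k hka
      · rw [branchCoeff_eq_of_lt hn (b' := false) (by simp only at h; omega)]
        exact h2 k (by simp only at h; omega)
    · exact h2 k h.2

/-- The coefficients of the Poincaré series. -/
def poincareCoeff {A : Type*} [CommRing A] (q : A) (n a b : ℕ) : A :=
  if n ≤ a ∧ n ≤ b then (1 - q) * q ^ (a + b - n) else if a = b then q ^ a else 0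

lemma poincareCoeff_comm {A : Type*} [CommRing A] (q : A) (n a b : ℕ) :
    poincareCoeff q n a b = poincareCoeff q n b a := by
  simp only [poincareCoeff, and_comm, add_comm a b]
  by_cases h : a = b
  · simp [h]
  · simp [h, Ne.symm h]

lemma HasMeasure.congr {A B : Set (ℙ ℂ germs)} {c : K0L} (h : HasMeasure B c)
    (hAB : ∀ p, p ∈ A ↔ p ∈ B) : HasMeasure A c := by
  rw [Set.ext hAB]; exact h

lemma hasMeasure_stdArc_ord (a b : ℕ) :
    HasMeasure {p : ℙ ℂ germs | (stdArc hn true).ord p.rep.1 = a ∧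
      (stdArc hn false).ord p.rep.1 = b} (poincareCoeff qL n a b) := by
  by_cases hab : n ≤ a ∧ n ≤ b
  · have hc : (orderConditions n a b).card = a + b - n := by
      rw [card_orderConditions, branchCodim]; omega
    have h := hasMeasure_linearStratum_inter hn (T := orderConditions n a b) (i := (true, a))
      (j := (false, b)) (by simp [mem_orderConditions]; omega) (by simp [mem_orderConditions])
      (by simp) (by
        intro s hs
        rcases Finset.mem_insert.1 hs with rfl | hs
        · exact Or.inl rfl
        rcases Finset.mem_insert.1 hs with rfl | hs
        · exact Or.inr hab.2
        · exact isIndependentIndex_of_mem_orderConditions hs)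
    rw [hc] at h
    rw [poincareCoeff, if_pos hab, sub_mul, one_mul, ← pow_succ']
    refine h.congr fun p => ?_
    simp only [linearStratum, Set.mem_inter_iff, Set.mem_ofPred_eq, Finset.notMem_empty,
      false_imp_iff, implies_true, true_and, forall_mem_orderConditions_iff, le_stdArc_ord_iff,
      stdArc_ord_eq_iff]
    exact ⟨fun ⟨⟨h1, h2⟩, h3, h4⟩ => ⟨⟨⟨h1, h3⟩, h2⟩, h4⟩,
      fun ⟨⟨⟨h1, h3⟩, h2⟩, h4⟩ => ⟨⟨h1, h2⟩, h3, h4⟩⟩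
  · rw [poincareCoeff, if_neg hab]
    split_ifs with h
    -- Here `a < n`, so the leading coefficients on the two branches coincide and one nonvanishing
    -- condition serves for both.
    · subst h
      have hc : (orderConditions n a a).card = a := by
        rw [card_orderConditions, branchCodim]; omega
      have h := hasMeasure_linearStratum hn (T := orderConditions n a a) (i := (true, a))
        (by simp [mem_orderConditions]) (by
          intro s hs
          rcases Finset.mem_insert.1 hs with rfl | hs
          · exact Or.inl rfl
          · exact isIndependentIndex_of_mem_orderConditions hs)
      rw [hc] at h
      refine h.congr fun p => ?_
      simp only [linearStratum, Set.mem_ofPred_eq, forall_mem_orderConditions_iff,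
        le_stdArc_ord_iff, stdArc_ord_eq_iff, branchCoeff_eq_of_lt hn (show a < n by omega) false true]
      exact ⟨fun ⟨⟨h1, h2⟩, h3, _⟩ => ⟨⟨h1, h3⟩, h2⟩, fun ⟨⟨h1, h3⟩, h2⟩ => ⟨⟨h1, h2⟩, h3, h2⟩⟩
    · refine hasMeasure_empty.congr fun p => ?_
      simp only [Set.mem_ofPred_eq, Set.mem_empty_iff_false, iff_false, not_and, stdArc_ord_eq_iff]
      rintro ⟨h1, h2⟩ h3 h4
      -- For `a ≠ b` the smaller order is below `n`. The shared coefficient in that degree would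
      -- have to vanish on one branch and not on the other.
      rcases lt_trichotomy a b with hlt | heq | hlt
      · refine h2 ?_
        rw [branchCoeff_eq_of_lt hn (by omega) true false]
        exact h3 a hlt
      · exact h heq
      · refine h4 ?_
        rw [branchCoeff_eq_of_lt hn (by omega) false true]
        exact h1 b hlt

lemma forall_fin_two_of_ne {i j : Fin 2} (hij : i ≠ j) (P : Fin 2 → Prop) :
    (∀ k, P k) ↔ P i ∧ P j := by
  rw [Fin.forall_fin_two]
  fin_cases i <;> fin_cases j <;> simp_all [and_comm]

/-- It is not known which of the two uniformisations is which branch; symmetry of the answer makes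
this irrelevant. -/
lemma exists_comm_of_ne {α β : Type*} {i j : Fin 2} (hij : i ≠ j) (F : α → α → β)
    (hF : ∀ a b, F a b = F b a) (v : Fin 2 → α) : F (v i) (v j) = F (v 0) (v 1) := by
  fin_cases i <;> fin_cases j <;> simp_all

lemma IsUniformization.hasMeasure_levelSet (hn : 1 ≤ n) {γ : Fin 2 → Arc}
    (hγ : IsUniformization (MvPowerSeries.X 1 ^ 2 - MvPowerSeries.X 0 ^ (2 * n)) γ)
    (v : Fin 2 →₀ ℕ) : HasMeasure (levelSet γ v) (poincareCoeff qL n (v 0) (v 1)) := by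
  obtain ⟨i, j, hij, hi, hj⟩ := hγ.exists_stdArc hn
  rw [← exists_comm_of_ne hij (poincareCoeff qL n) (poincareCoeff_comm qL n) v]
  refine (hasMeasure_stdArc_ord hn (v i) (v j)).congr fun p => ?_
  simp only [levelSet, Set.mem_ofPred_eq, forall_fin_two_of_ne hij, hi, hj]

/-- The filtration subspace is the kernel of a surjection onto a space with one coordinate for each
order condition, so its codimension is their number. -/
lemma IsUniformization.codim_eq (hn : 1 ≤ n) {γ : Fin 2 → Arc}
    (hγ : IsUniformization (MvPowerSeries.X 1 ^ 2 - MvPowerSeries.X 0 ^ (2 * n)) γ)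
    (v : Fin 2 → ℤ) : codim γ v = branchCodim n (v 0).toNat (v 1).toNat := by
  obtain ⟨i, j, hij, hi, hj⟩ := hγ.exists_stdArc hn
  rw [← exists_comm_of_ne hij (fun a b : ℤ => branchCodim n a.toNat b.toNat)
    (fun _ _ => branchCodim_comm _ _ _) v]
  set S := orderConditions n (v i).toNat (v j).toNat with hS
  have hker : filtration γ v = LinearMap.ker (LinearMap.pi fun s : S => branchCoeff hn s.1) := by
    ext f
    have h1 : f ∈ filtration γ v ↔ ∀ k, ((v k).toNat : ℕ∞) ≤ (γ k).ord f.1 := Iff.rfl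
    rw [h1, forall_fin_two_of_ne hij, hi, hj, ← forall_mem_orderConditions_iff, LinearMap.mem_ker,
      funext_iff]
    simp [hS]
  have hsurj := pi_branchCoeff_surjective hn S
    fun _ hs => isIndependentIndex_of_mem_orderConditions hs
  rw [codim, hker, (LinearMap.quotKerEquivOfSurjective _ hsurj).finrank_eq,
    Module.finrank_fintype_fun_eq_card, Fintype.card_coe, card_orderConditions]

end

/-! ### The Poincaré series -/

section
variable {A : Type*} [CommRing A]

/-- The Poincaré series of the singularity `A_{2n-1}`. -/
def poincareSeries (q : A) (n : ℕ) : MvPowerSeries (Fin 2) A :=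
  fun v => poincareCoeff q n (v 0) (v 1)

lemma coeff_poincareSeries (q : A) (n : ℕ) (v : Fin 2 →₀ ℕ) :
    MvPowerSeries.coeff v (poincareSeries q n) = poincareCoeff q n (v 0) (v 1) := rfl

/-- The series `∑ q ^ (a + b) t_1 ^ a t_2 ^ b`. -/
def geometricSeries (q : A) : MvPowerSeries (Fin 2) A := fun v => q ^ (v 0 + v 1)

lemma coeff_X_mul (i : Fin 2) (f : MvPowerSeries (Fin 2) A) (v : Fin 2 →₀ ℕ) :
    MvPowerSeries.coeff v (MvPowerSeries.X i * f) =
      if 1 ≤ v i then MvPowerSeries.coeff (v - Finsupp.single i 1) f else 0 := by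
  rw [MvPowerSeries.X, MvPowerSeries.coeff_monomial_mul]
  simp only [Finsupp.single_le_iff, one_mul]

lemma X_mul_X_pow (k : ℕ) : (MvPowerSeries.X 0 * MvPowerSeries.X 1 : MvPowerSeries (Fin 2) A) ^ k =
    MvPowerSeries.monomial (Finsupp.single 0 k + Finsupp.single 1 k) 1 := by
  rw [mul_pow, MvPowerSeries.X_pow_eq, MvPowerSeries.X_pow_eq, MvPowerSeries.monomial_mul_monomial,
    one_mul]

lemma coeff_X_mul_X_pow_mul (k : ℕ) (f : MvPowerSeries (Fin 2) A) (v : Fin 2 →₀ ℕ) :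
    MvPowerSeries.coeff v ((MvPowerSeries.X 0 * MvPowerSeries.X 1) ^ k * f) =
      if k ≤ v 0 ∧ k ≤ v 1 then
        MvPowerSeries.coeff (v - (Finsupp.single 0 k + Finsupp.single 1 k)) f else 0 := by
  rw [X_mul_X_pow, MvPowerSeries.coeff_monomial_mul, one_mul]
  refine if_congr ?_ rfl rfl
  rw [Finsupp.le_def, Fin.forall_fin_two]
  simp

lemma coeff_X_mul_X_pow (k : ℕ) (v : Fin 2 →₀ ℕ) :
    MvPowerSeries.coeff v ((MvPowerSeries.X 0 * MvPowerSeries.X 1 : MvPowerSeries (Fin 2) A) ^ k) =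
      if v 0 = k ∧ v 1 = k then 1 else 0 := by
  classical
  rw [X_mul_X_pow, MvPowerSeries.coeff_monomial]
  refine if_congr ?_ rfl rfl
  rw [DFunLike.ext_iff, Fin.forall_fin_two]
  simp

lemma mul_geometricSeries (q : A) :
    (1 - MvPowerSeries.C q * MvPowerSeries.X 0) * (1 - MvPowerSeries.C q * MvPowerSeries.X 1) *
      geometricSeries q = 1 := by
  classical
  -- `H` is `∑ q ^ b t_2 ^ b`: the first factor telescopes the double series to `H`, the second
  -- telescopes `H` to `1`.
  let H : MvPowerSeries (Fin 2) A := fun v => if v 0 = 0 then q ^ v 1 else 0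
  have hH : ∀ v, MvPowerSeries.coeff v H = if v 0 = 0 then q ^ v 1 else 0 := fun _ => rfl
  have hG : ∀ v, MvPowerSeries.coeff v (geometricSeries q) = q ^ (v 0 + v 1) := fun _ => rfl
  have h1 : (1 - MvPowerSeries.C q * MvPowerSeries.X 0) * geometricSeries q = H := by
    ext v
    rw [sub_mul, one_mul, mul_assoc, map_sub, MvPowerSeries.coeff_C_mul, coeff_X_mul, hH, hG]
    rcases Nat.eq_zero_or_pos (v 0) with h | (h : 1 ≤ v 0)
    · simp [h]
    · rw [if_pos h, if_neg (by omega), hG, ← pow_succ']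
      simp only [Finsupp.tsub_apply, Finsupp.single_eq_same, ne_eq, one_ne_zero, not_false_eq_true,
        Finsupp.single_eq_of_ne, tsub_zero]
      rw [show v 0 - 1 + v 1 + 1 = v 0 + v 1 by omega, sub_self]
  have h2 : (1 - MvPowerSeries.C q * MvPowerSeries.X 1) * H = 1 := by
    ext v
    rw [sub_mul, one_mul, mul_assoc, map_sub, MvPowerSeries.coeff_C_mul, coeff_X_mul, hH,
      MvPowerSeries.coeff_one]
    have h0 : v = 0 ↔ v 0 = 0 ∧ v 1 = 0 := by
      rw [DFunLike.ext_iff, Fin.forall_fin_two]; rfl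
    rw [if_congr h0 rfl rfl]
    rcases Nat.eq_zero_or_pos (v 1) with h | (h : 1 ≤ v 1)
    · simp [h]
    · rw [if_pos h, hH, if_neg (fun h' : v 0 = 0 ∧ v 1 = 0 => by omega)]
      simp only [Finsupp.tsub_apply, Finsupp.single_eq_same, ne_eq, zero_ne_one, not_false_eq_true,
        Finsupp.single_eq_of_ne, tsub_zero]
      split_ifs
      · rw [← pow_succ', Nat.sub_add_cancel h, sub_self]
      · rw [mul_zero, sub_self]
  rw [mul_comm (1 - MvPowerSeries.C q * MvPowerSeries.X 0), mul_assoc, h1, h2]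

/-- The support consists of the diagonal below `n` and the quadrant from `(n, n)` on; on the latter
the series is a shifted geometric series. -/
lemma poincareSeries_eq (q : A) (n : ℕ) : poincareSeries q n =
    ∑ k ∈ Finset.range n, MvPowerSeries.C q ^ k * (MvPowerSeries.X 0 * MvPowerSeries.X 1) ^ k +
      (1 - MvPowerSeries.C q) * MvPowerSeries.C q ^ n *
        ((MvPowerSeries.X 0 * MvPowerSeries.X 1) ^ n * geometricSeries q) := by
  ext v
  rw [coeff_poincareSeries, map_add, map_sum]
  have h1 : (1 - MvPowerSeries.C q) * MvPowerSeries.C q ^ n =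
      (MvPowerSeries.C ((1 - q) * q ^ n) : MvPowerSeries (Fin 2) A) := by simp
  simp only [h1]
  simp only [← map_pow, MvPowerSeries.coeff_C_mul, coeff_X_mul_X_pow, coeff_X_mul_X_pow_mul]
  have hG : ∀ v, MvPowerSeries.coeff v (geometricSeries q) = q ^ (v 0 + v 1) := fun _ => rfl
  rw [hG]
  simp only [Finsupp.tsub_apply, Finsupp.add_apply, Finsupp.single_eq_same, ne_eq, one_ne_zero,
    zero_ne_one, not_false_eq_true, Finsupp.single_eq_of_ne, add_zero, zero_add, mul_ite, mul_one,
    mul_zero]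
  rw [poincareCoeff]
  by_cases h : n ≤ v 0 ∧ n ≤ v 1
  · rw [if_pos h, if_pos h, Finset.sum_eq_zero, zero_add, mul_assoc, ← pow_add]
    · congr 2; omega
    · intro k hk
      rw [Finset.mem_range] at hk
      rw [if_neg (by omega)]
  · rw [if_neg h, if_neg h, add_zero]
    by_cases h2 : v 0 = v 1
    · rw [if_pos h2, Finset.sum_eq_single (v 0)]
      · rw [if_pos ⟨rfl, h2.symm⟩]
      · intro k _ hk
        rw [if_neg fun h => hk h.1.symm]
      · intro hk
        rw [Finset.mem_range] at hk
        omega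
    · rw [if_neg h2, Finset.sum_eq_zero]
      intro k _
      rw [if_neg fun h => h2 (h.1.trans h.2.symm)]

/-- Induction on `n`: each step adds one diagonal term, and the increments agree as polynomials. It
is applied with `c`, `x`, `y` in the power series ring. -/
lemma reduced_sum_identity (c x y : A) {n : ℕ} (hn : 1 ≤ n) :
    (1 - c * x) * (1 - c * y) * ∑ k ∈ Finset.range n, c ^ k * (x * y) ^ k +
        (1 - c) * c ^ n * (x * y) ^ n =
      (1 + ∑ k ∈ Finset.Ico 1 n, (c ^ k + c ^ (k + 1)) * (x * y) ^ k + c ^ n * (x * y) ^ n) -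
        (x + y) * ∑ k ∈ Finset.range n, c ^ (k + 1) * (x * y) ^ k := by
  induction n, hn using Nat.le_induction with
  | base => simp; ring
  | succ n hn ih =>
    rw [Finset.sum_range_succ, Finset.sum_range_succ, Finset.sum_Ico_succ_top hn]
    linear_combination ih

theorem reduced_poincareSeries (q : A) {n : ℕ} (hn : 1 ≤ n) :
    reduced q (poincareSeries q n) =
      (1 + ∑ k ∈ Finset.Ico 1 n, MvPowerSeries.C (q ^ k + q ^ (k + 1)) *
              (MvPowerSeries.X 0 * MvPowerSeries.X 1) ^ k
          + MvPowerSeries.C (q ^ n) * (MvPowerSeries.X 0 * MvPowerSeries.X 1) ^ n)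
        - (MvPowerSeries.X 0 + MvPowerSeries.X 1) *
            ∑ k ∈ Finset.range n, MvPowerSeries.C (q ^ (k + 1)) *
              (MvPowerSeries.X 0 * MvPowerSeries.X 1) ^ k := by
  simp only [map_add, map_pow]
  rw [← reduced_sum_identity _ _ _ hn, reduced, Fin.prod_univ_two, poincareSeries_eq]
  linear_combination (1 - MvPowerSeries.C q) * MvPowerSeries.C q ^ n *
    (MvPowerSeries.X 0 * MvPowerSeries.X 1) ^ n * mul_geometricSeries q

/-- This is inclusion-exclusion: up to a constant that cancels in the alternating sum, the
projectivisation of a subspace of codimension `h` has measure `q ^ h / (1 - q)`, and the level set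
arises from four such subspaces. -/
lemma branchCodim_second_difference (q : A) (n a b : ℕ) :
    q ^ branchCodim n (a + 1) (b + 1) - q ^ branchCodim n a (b + 1) -
      q ^ branchCodim n (a + 1) b + q ^ branchCodim n a b = (1 - q) * poincareCoeff q n a b := by
  rw [poincareCoeff]
  split_ifs with h1 h2
  · rw [show branchCodim n (a + 1) (b + 1) = a + b - n + 2 by unfold branchCodim; omega,
      show branchCodim n a (b + 1) = a + b - n + 1 by unfold branchCodim; omega,
      show branchCodim n (a + 1) b = a + b - n + 1 by unfold branchCodim; omega,
      show branchCodim n a b = a + b - n by unfold branchCodim; omega]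
    ring
  · subst h2
    rw [show branchCodim n (a + 1) (a + 1) = a + 1 by unfold branchCodim; omega,
      show branchCodim n a (a + 1) = a + 1 by unfold branchCodim; omega,
      show branchCodim n (a + 1) a = a + 1 by unfold branchCodim; omega,
      show branchCodim n a a = a by unfold branchCodim; omega]
    ring
  · rcases Nat.lt_or_gt_of_ne h2 with h | h
    · rw [show branchCodim n (a + 1) (b + 1) = branchCodim n a (b + 1) by unfold branchCodim; omega,
        show branchCodim n (a + 1) b = branchCodim n a b by unfold branchCodim; omega]
      ring
    · rw [show branchCodim n (a + 1) (b + 1) = branchCodim n (a + 1) b by unfold branchCodim; omega,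
        show branchCodim n a (b + 1) = branchCodim n a b by unfold branchCodim; omega]
      ring

end

/-! ### The series of the filtration. -/

lemma one_sub_X_mul_lCoeff {r : ℕ} {γ : Fin r → Arc} {v : Fin r → ℤ}
    (h : codim γ v ≤ codim γ (v + 1)) : (1 - Polynomial.X) * lCoeff γ v =
      Polynomial.X ^ codim γ v - Polynomial.X ^ codim γ (v + 1) := by
  have := geom_sum_Ico_mul (Polynomial.X : Polynomial ℤ) h
  rw [lCoeff]
  linear_combination -this

/-- After multiplication by `1 - q`, the alternating sum over `I` is the second difference of `q ^
h` based at `v - 1` minus the one based at `v`. These are the contributions of `t_1 t_2` and of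
`-1`. -/
lemma IsUniformization.lSeriesMul_eq {n : ℕ} (hn : 1 ≤ n) {γ : Fin 2 → Arc}
    (hγ : IsUniformization (MvPowerSeries.X 1 ^ 2 - MvPowerSeries.X 0 ^ (2 * n)) γ) :
    lSeriesMul γ = (MvPowerSeries.X 0 * MvPowerSeries.X 1 - 1) *
      poincareSeries (Polynomial.X : Polynomial ℤ) n := by
  have hX : (1 - Polynomial.X : Polynomial ℤ) ≠ 0 := by
    intro h
    simpa using congrArg (Polynomial.eval 0) h
  have hl : ∀ v : Fin 2 → ℤ, (1 - Polynomial.X) * lCoeff γ v =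
      Polynomial.X ^ branchCodim n (v 0).toNat (v 1).toNat -
        Polynomial.X ^ branchCodim n (v 0 + 1).toNat (v 1 + 1).toNat := by
    intro v
    rw [one_sub_X_mul_lCoeff]
    · rw [hγ.codim_eq hn, hγ.codim_eq hn]; rfl
    · rw [hγ.codim_eq hn, hγ.codim_eq hn]
      simp only [Pi.add_apply, Pi.one_apply, branchCodim]
      omega
  have hI : (Finset.univ : Finset (Finset (Fin 2))) = {∅, {0}, {1}, {0, 1}} := by decide
  ext1 v
  apply mul_left_cancel₀ hX
  have hv : MvPowerSeries.coeff v (lSeriesMul γ) = ∑ I : Finset (Fin 2), (-1) ^ (2 - I.card) *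
      lCoeff γ (fun i => (v i : ℤ) - if i ∈ I then 1 else 0) := rfl
  have hT := coeff_X_mul_X_pow_mul 1 (poincareSeries (Polynomial.X : Polynomial ℤ) n) v
  obtain ⟨w, hw⟩ : ∃ w : Fin 2 →₀ ℕ, w = v - (Finsupp.single 0 1 + Finsupp.single 1 1) := ⟨_, rfl⟩
  have hw0 : w 0 = v 0 - 1 := by simp [hw]
  have hw1 : w 1 = v 1 - 1 := by simp [hw]
  rw [pow_one, ← hw, coeff_poincareSeries, hw0, hw1] at hT
  rw [hv, hI, sub_mul _ _ (poincareSeries _ _), one_mul, map_sub, hT, coeff_poincareSeries]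
  rw [Finset.sum_insert (by decide), Finset.sum_insert (by decide), Finset.sum_insert (by decide),
    Finset.sum_singleton]
  have key := branchCodim_second_difference (Polynomial.X : Polynomial ℤ) n (v 0) (v 1)
  have e0 := hl fun i => (v i : ℤ) - if i ∈ (∅ : Finset (Fin 2)) then 1 else 0
  have e1 := hl fun i => (v i : ℤ) - if i ∈ ({0} : Finset (Fin 2)) then 1 else 0
  have e2 := hl fun i => (v i : ℤ) - if i ∈ ({1} : Finset (Fin 2)) then 1 else 0
  have e3 := hl fun i => (v i : ℤ) - if i ∈ ({0, 1} : Finset (Fin 2)) then 1 else 0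
  have t1 : ∀ a : ℕ, ((a : ℤ) - 1).toNat = a - 1 := fun a => by omega
  have t2 : ∀ a : ℕ, ((a : ℤ) + 1).toNat = a + 1 := fun a => by omega
  simp only [Finset.notMem_empty, Finset.mem_singleton, Finset.mem_insert, if_true, if_false,
    zero_ne_one, one_ne_zero, true_or, or_true, sub_zero, sub_add_cancel, t1, t2, Int.toNat_natCast]
    at e0 e1 e2 e3
  have c0 : (∅ : Finset (Fin 2)).card = 0 := rfl
  have c1 : ({0} : Finset (Fin 2)).card = 1 := rfl
  have c2 : ({1} : Finset (Fin 2)).card = 1 := rfl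
  have c3 : ({0, 1} : Finset (Fin 2)).card = 2 := rfl
  simp only [c0, c1, c2, c3, Finset.notMem_empty, Finset.mem_singleton, Finset.mem_insert, if_false,
    sub_zero]
  -- If some coordinate of `v` is `0`, truncated subtraction leaves it fixed and the second
  -- difference cancels in pairs. This matches the zero coefficient of the series shifted by `t_1
  -- t_2`.
  have hcorner : (1 - Polynomial.X : Polynomial ℤ) * (if 1 ≤ v 0 ∧ 1 ≤ v 1 then
      poincareCoeff Polynomial.X n (v 0 - 1) (v 1 - 1) else 0) =
      Polynomial.X ^ branchCodim n (v 0) (v 1) - Polynomial.X ^ branchCodim n (v 0 - 1) (v 1) -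
        Polynomial.X ^ branchCodim n (v 0) (v 1 - 1) +
        Polynomial.X ^ branchCodim n (v 0 - 1) (v 1 - 1) := by
    split_ifs with h
    · rw [← branchCodim_second_difference, Nat.sub_add_cancel h.1, Nat.sub_add_cancel h.2]
    · rcases Nat.eq_zero_or_pos (v 0) with h0 | h0
      · rw [h0]; simp
      · rw [show v 1 = 0 by omega]; simp
  linear_combination e0 - e1 - e2 + e3 - hcorner - key

lemma IsUniformization.filtrationSeries_eq {n : ℕ} (hn : 1 ≤ n) {γ : Fin 2 → Arc}
    (hγ : IsUniformization (MvPowerSeries.X 1 ^ 2 - MvPowerSeries.X 0 ^ (2 * n)) γ) :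
    filtrationSeries γ = poincareSeries (Polynomial.X : Polynomial ℤ) n := by
  -- The constant term of `t_1 t_2 - 1` is the unit `-1`, so the factor cancels against its inverse
  -- series.
  rw [filtrationSeries, hγ.lSeriesMul_eq hn, Fin.prod_univ_two, mul_right_comm,
    MvPowerSeries.mul_invOfUnit _ _ (by simp), one_mul]

end MotivicPoincare

end

theorem corollary3 (n : ℕ) (hn : 1 ≤ n) (γ : Fin 2 → MotivicPoincare.Arc)
    (hγ : MotivicPoincare.IsUniformization
      (MvPowerSeries.X 1 ^ 2 - MvPowerSeries.X 0 ^ (2 * n)) γ) :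
    (∀ v : Fin 2 →₀ ℕ, MotivicPoincare.IsCylindric (MotivicPoincare.levelSet γ v)) ∧
    MotivicPoincare.reduced MotivicPoincare.qL (MotivicPoincare.motivicSeries γ) =
      (1 + ∑ k ∈ Finset.Ico 1 n,
            MvPowerSeries.C (MotivicPoincare.qL ^ k + MotivicPoincare.qL ^ (k + 1)) *
              (MvPowerSeries.X 0 * MvPowerSeries.X 1) ^ k
          + MvPowerSeries.C (MotivicPoincare.qL ^ n) *
              (MvPowerSeries.X 0 * MvPowerSeries.X 1) ^ n)
        - (MvPowerSeries.X 0 + MvPowerSeries.X 1) *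
            ∑ k ∈ Finset.range n, MvPowerSeries.C (MotivicPoincare.qL ^ (k + 1)) *
              (MvPowerSeries.X 0 * MvPowerSeries.X 1) ^ k ∧
    MotivicPoincare.reduced (Polynomial.X : Polynomial ℤ)
        (MotivicPoincare.filtrationSeries γ) =
      (1 + ∑ k ∈ Finset.Ico 1 n,
            MvPowerSeries.C ((Polynomial.X : Polynomial ℤ) ^ k + Polynomial.X ^ (k + 1)) *
              (MvPowerSeries.X 0 * MvPowerSeries.X 1) ^ k
          + MvPowerSeries.C ((Polynomial.X : Polynomial ℤ) ^ n) *
              (MvPowerSeries.X 0 * MvPowerSeries.X 1) ^ n)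
        - (MvPowerSeries.X 0 + MvPowerSeries.X 1) *
            ∑ k ∈ Finset.range n, MvPowerSeries.C ((Polynomial.X : Polynomial ℤ) ^ (k + 1)) *
              (MvPowerSeries.X 0 * MvPowerSeries.X 1) ^ k := by

  refine ⟨fun v => ⟨_, hγ.hasMeasure_levelSet hn v⟩, ?_, ?_⟩
  · rw [← MotivicPoincare.reduced_poincareSeries _ hn]
    congr 1
    exact funext fun v => (hγ.hasMeasure_levelSet hn v).motivicMeasure_eq
  · rw [← MotivicPoincare.reduced_poincareSeries _ hn, hγ.filtrationSeries_eq hn]
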